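/- **Setting.** $N\ge 1$ identical players extract a nonrenewable resource with stock $y(s)\in X=(0,\infty)$, $\dot y=-\sum_{j=1}^N u^j$, $y(t)=x$. Rates lie in an interval $U\subseteq[0,\infty)$. Player $i$ has utility $L^i(u^1,\dots,u^N)$, of class $C^2$ on a neighbourhood of $U^N$; $L^i$ is the same function of own rate and others' rates for all $i$ and is invariant under permutations of the others' rates, with $L^i_{u^i}>0$ and $L^i_{u^iu^i}<0$ on $U^N$. The common discount rate is $r>0$, and the payoff is $\int_t^T e^{-r(s-t)}L^i\,ds+e^{-r(T-t)}B(y(T))$ with $B\in C^2(X)$ if $T<\infty$, and $\int_0^\infty e^{-rs}L^i\,ds$ (required to converge absolutely) with no bequest if $T=\infty$. Strategies are $C^1$ feedback rules $u^i(t,x)$ on $[0,T]\times X$ with values in $U$ (stationary rules $u^i(x)$ if $T=\infty$); they are admissible for given dynamics if the closed-loop equation has a unique solution, staying in $X$ up to the horizon, from every initial condition. A Markov perfect Nash equilibrium (MPNE) is an admissible profile from which no player gains, at any initial condition, by a unilateral admissible deviation (with convergent payoff if $T=\infty$). Put $$E_i=-\frac{L^i_{u^i}}{\sum_{j}L^i_{u^iu^j}},\qquad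 E_{-i}=-\frac{\sum_{j\ne i}L^i_{u^j}}{(N-1)\sum_j L^i_{u^iu^j}}\quad(E_{-i}=0\text{ if }N=1),$$ assume $E_i>0$ on $U^N$, and let $e_1(u)=E_1(u,\dots,u)$, $e_{-1}(u)=E_{-1}(u,\dots,u)$ and $$f(u)=-Nu+(N-1)\big(e_1(u)-e_{-1}(u)\big).$$ Assume that $f$ is of class $C^2$ on $U$ with $f'\neq0$. **Theorem.** There are constants $C\ne0$ with $Cf'\ge0$ on $U$. Let $C$ be any constant with $Cf'\ge 0$ on $U$. Let $u^*$ be a rule with values in the interior of $U$ such that $(u^*,\dots,u^*)$ is an MPNE, and suppose that $u^*$ is also admissible for the dynamics $\dot z=f(u)$. Let $\rho\ge0$ if $T<\infty$ and $\rho>0$ if $T=\infty$. Then $u^*$ is rationalized by the fictitious monopoly $(\ell,\rho,f,b)$, i.e. $u^*$ maximizes $$\int_t^T e^{-\rho(s-t)}\ell(v(s,z(s)))\,ds+e^{-\rho(T-t)}b(z(T)),\qquad \dot z=f(v(s,z)),\quad z(t)=x,$$ at every initial condition $(t,x)$, over all $C^1$ feedback rules $v$ with values in $U$ that generate a trajectory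 in $X$ up to the horizon from $(t,x)$ (if $T=\infty$: $t=0$, stationary $v$, no bequest, the payoff of $u^*$ converges absolutely, and $v$ ranges over rules with absolutely convergent payoff), where $$\ell(u)=Cf(u)e^{-\frac{\rho}{r}\int_{u_0}^{u}\frac{dv}{e_1(v)}}+C\frac{\rho}{r}\int_{u_0}^u\frac{f(v)}{e_1(v)}e^{-\frac{\rho}{r}\int_{u_0}^{v}\frac{dw}{e_1(w)}}\,dv+c_1,$$ and, for $T<\infty$ and with $\varphi(x)=u^*(T,x)$, $$b(x)=-C\int_{x_0}^x e^{-\frac{\rho}{r}\int_{x_0}^{w}\frac{\varphi'(z)}{e_1(\varphi(z))}\,dz}\,dw+c_2,$$ while $b=0$ if $T=\infty$. Here $c_1,c_2$ are arbitrary constants, $x_0\in X$ is arbitrary and $u_0=\varphi(x_0)$ if $T<\infty$, and $u_0\in U$ is arbitrary if $T=\infty$. Moreover $\ell$ is $C^2$ on $U$ and $b$ is $C^2$ on $X$. -/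

import Mathlib

open Set MeasureTheory

noncomputable section

/-! ### Feedback controls for a scalar state and a control with values in `V`

The state (the stock of the resource) lives in `(0, ∞)`, and the dynamics `F : V → ℝ` depends on the
control only. -/

section Control

variable {V : Type*} [NormedAddCommGroup V] [NormedSpace ℝ V]

/-- A feedback rule of class `C¹` on `[0, T] × (0, ∞)` with values in the control region `W`. -/
def IsFeedback (T : ℝ) (W : Set V) (Φ : ℝ → ℝ → V) : Prop :=
  ContDiffOn ℝ 1 (fun q : ℝ × ℝ => Φ q.1 q.2) (Icc 0 T ×ˢ Ioi 0) ∧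
    ∀ t ∈ Icc 0 T, ∀ x ∈ Ioi (0 : ℝ), Φ t x ∈ W

/-- `y` solves `y' (s) = F (Φ (s, y s))`, `t ≤ s ≤ T`, `y t = x`, and stays in `(0, ∞)`. -/
def IsTrajectory (F : V → ℝ) (Φ : ℝ → ℝ → V) (T t x : ℝ) (y : ℝ → ℝ) : Prop :=
  y t = x ∧ ∀ s ∈ Icc t T, 0 < y s ∧ HasDerivWithinAt y (F (Φ s (y s))) (Icc t T) s

/-- Admissible feedback rules on the finite horizon `[0, T]`: from every initial condition
`(t, x)` the state equation has a unique solution. -/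
def Admissible (F : V → ℝ) (T : ℝ) (W : Set V) (Φ : ℝ → ℝ → V) : Prop :=
  IsFeedback T W Φ ∧ ∀ t ∈ Icc 0 T, ∀ x ∈ Ioi (0 : ℝ),
    (∃ y, IsTrajectory F Φ T t x y) ∧
      ∀ y₁ y₂, IsTrajectory F Φ T t x y₁ → IsTrajectory F Φ T t x y₂ → EqOn y₁ y₂ (Icc t T)

/-- The payoff `∫_t^T e^{-r(s-t)} L(Φ(s, y s)) ds + e^{-r(T-t)} B(y T)` along `y`. -/
def payoff (L : V → ℝ) (r : ℝ) (B : ℝ → ℝ) (Φ : ℝ → ℝ → V) (T t : ℝ) (y : ℝ → ℝ) : ℝ :=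
  (∫ s in t..T, Real.exp (-r * (s - t)) * L (Φ s (y s))) + Real.exp (-r * (T - t)) * B (y T)

/-- A stationary feedback rule of class `C¹` on `(0, ∞)` with values in `W`. -/
def IsStatFeedback (W : Set V) (Φ : ℝ → V) : Prop :=
  ContDiffOn ℝ 1 Φ (Ioi 0) ∧ ∀ x ∈ Ioi (0 : ℝ), Φ x ∈ W

/-- `y` solves `y' (s) = F (Φ (y s))`, `s ≥ 0`, `y 0 = x`, and stays in `(0, ∞)`. -/
def IsStatTrajectory (F : V → ℝ) (Φ : ℝ → V) (x : ℝ) (y : ℝ → ℝ) : Prop :=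
  y 0 = x ∧ ∀ s ∈ Ici (0 : ℝ), 0 < y s ∧ HasDerivWithinAt y (F (Φ (y s))) (Ici 0) s

/-- Admissible stationary feedback rules on `[0, ∞)`. -/
def StatAdmissible (F : V → ℝ) (W : Set V) (Φ : ℝ → V) : Prop :=
  IsStatFeedback W Φ ∧ ∀ x ∈ Ioi (0 : ℝ),
    (∃ y, IsStatTrajectory F Φ x y) ∧
      ∀ y₁ y₂, IsStatTrajectory F Φ x y₁ → IsStatTrajectory F Φ x y₂ → EqOn y₁ y₂ (Ici 0)

/-- The discounted instantaneous payoff along `y` on the infinite horizon. -/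
def statIntegrand (L : V → ℝ) (r : ℝ) (Φ : ℝ → V) (y : ℝ → ℝ) (s : ℝ) : ℝ :=
  Real.exp (-r * s) * L (Φ (y s))

/-- The infinite-horizon payoff converges along `y`. -/
def StatConverges (L : V → ℝ) (r : ℝ) (Φ : ℝ → V) (y : ℝ → ℝ) : Prop :=
  IntegrableOn (statIntegrand L r Φ y) (Ioi 0)

/-- The infinite-horizon payoff `∫_0^∞ e^{-rs} L(Φ(y s)) ds` along `y`. -/
def statPayoff (L : V → ℝ) (r : ℝ) (Φ : ℝ → V) (y : ℝ → ℝ) : ℝ :=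
  ∫ s in Ioi 0, statIntegrand L r Φ y s

end Control

/-! ### The symmetric oligopoly -/

/-- Partial derivative of `g` with respect to the `j`-th coordinate. -/
def partialD {N : ℕ} (j : Fin N) (g : (Fin N → ℝ) → ℝ) (v : Fin N → ℝ) : ℝ :=
  deriv (fun s => g (Function.update v j s)) (v j)

/-- Data of the oligopoly: control region `U`, utilities `L i` (as functions of the whole profile of
extraction rates), common discount rate `r` and common bequest function `B`. -/
structure Oligopoly (N : ℕ) where
  U : Set ℝ
  L : Fin N → (Fin N → ℝ) → ℝ
  r : ℝ
  B : ℝ → ℝ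

namespace Oligopoly

variable {N : ℕ} (G : Oligopoly N)

/-- Control region of the profile of all players. -/
def profiles : Set (Fin N → ℝ) := {v | ∀ i, v i ∈ G.U}

/-- The stock decreases at the total extraction rate. -/
def dyn (v : Fin N → ℝ) : ℝ := -∑ j, v j

/-- `E_i = - L^i_{u^i} / ∑_j L^i_{u^i u^j}`. -/
def E (i : Fin N) (v : Fin N → ℝ) : ℝ :=
  -(partialD i (G.L i) v / ∑ j, partialD j (partialD i (G.L i)) v)

/-- `E_{-i} = - ∑_{j ≠ i} L^i_{u^j} / ((N-1) ∑_j L^i_{u^i u^j})`; it is `0` if `N = 1`. -/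
def EOther (i : Fin N) (v : Fin N → ℝ) : ℝ :=
  -((∑ j ∈ Finset.univ.erase i, partialD j (G.L i) v) /
    (((N : ℝ) - 1) * ∑ j, partialD j (partialD i (G.L i)) v))

/-- Standing assumptions on the symmetric oligopoly. -/
structure Standard : Prop where
  /-- extraction rates are nonnegative and form an interval -/
  U_interval : G.U.OrdConnected
  U_nonneg : ∀ u ∈ G.U, 0 ≤ u
  /-- utilities are `C²` on a neighbourhood of the control region -/
  L_smooth : ∃ O : Set (Fin N → ℝ), IsOpen O ∧ G.profiles ⊆ O ∧ ∀ i, ContDiffOn ℝ 2 (G.L i) O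
  /-- symmetry: all players have the same utility of own and others' rates, and it is invariant
  under permutations of the others' rates -/
  L_symm : ∀ (σ : Equiv.Perm (Fin N)) (i : Fin N), ∀ v ∈ G.profiles, G.L (σ i) v = G.L i (v ∘ σ)
  L_incr : ∀ i, ∀ v ∈ G.profiles, 0 < partialD i (G.L i) v
  L_concave : ∀ i, ∀ v ∈ G.profiles, partialD i (partialD i (G.L i)) v < 0
  E_pos : ∀ i, ∀ v ∈ G.profiles, 0 < G.E i v
  r_pos : 0 < G.r
  B_smooth : ContDiffOn ℝ 2 G.B (Ioi 0)

/-- Markov perfect Nash equilibrium on `[0, T]`; `Φ t x` is the profile of rates at `(t, x)`. -/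
def IsMPNE (T : ℝ) (Φ : ℝ → ℝ → Fin N → ℝ) : Prop :=
  Admissible dyn T G.profiles Φ ∧
    ∀ (i : Fin N) (w : ℝ → ℝ → ℝ),
      Admissible dyn T G.profiles (fun t x => Function.update (Φ t x) i (w t x)) →
      ∀ t ∈ Icc 0 T, ∀ x ∈ Ioi (0 : ℝ), ∀ y' y,
        IsTrajectory dyn (fun t x => Function.update (Φ t x) i (w t x)) T t x y' →
        IsTrajectory dyn Φ T t x y →
        payoff (G.L i) G.r G.B (fun t x => Function.update (Φ t x) i (w t x)) T t y' ≤
          payoff (G.L i) G.r G.B Φ T t y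

/-- Stationary Markov perfect Nash equilibrium on `[0, ∞)` (no bequest): equilibrium payoffs
converge, and no deviation with a convergent payoff is profitable. -/
def IsStatMPNE (Φ : ℝ → Fin N → ℝ) : Prop :=
  StatAdmissible dyn G.profiles Φ ∧
    ∀ i : Fin N, ∀ x ∈ Ioi (0 : ℝ), ∀ y, IsStatTrajectory dyn Φ x y →
      StatConverges (G.L i) G.r Φ y ∧
      ∀ w : ℝ → ℝ,
        StatAdmissible dyn G.profiles (fun x => Function.update (Φ x) i (w x)) →
        ∀ y', IsStatTrajectory dyn (fun x => Function.update (Φ x) i (w x)) x y' →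
          StatConverges (G.L i) G.r (fun x => Function.update (Φ x) i (w x)) y' →
          statPayoff (G.L i) G.r (fun x => Function.update (Φ x) i (w x)) y' ≤
            statPayoff (G.L i) G.r Φ y

variable [NeZero N]

/-- `e₁(u) = E₁(u, …, u)`; the players are numbered from `0`. -/
def e (u : ℝ) : ℝ := G.E 0 (fun _ => u)

/-- `e₋₁(u) = E₋₁(u, …, u)`. -/
def eOther (u : ℝ) : ℝ := G.EOther 0 (fun _ => u)

/-- Dynamics of the fictitious monopoly. -/
def f (u : ℝ) : ℝ := -(N : ℝ) * u + ((N : ℝ) - 1) * (G.e u - G.eOther u)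

/-- `exp(-(ρ/r) ∫_{u₀}^u dv / e₁(v))`. -/
def expFactor (ρ u₀ u : ℝ) : ℝ := Real.exp (-(ρ / G.r) * ∫ v in u₀..u, 1 / G.e v)

/-- Payoff integrand of the fictitious monopoly; `u₀`, `C` and `c` fix the indefinite integrals. -/
def ell (ρ C c u₀ u : ℝ) : ℝ :=
  C * G.f u * G.expFactor ρ u₀ u +
    C * (ρ / G.r) * (∫ v in u₀..u, G.f v / G.e v * G.expFactor ρ u₀ v) + c

/-- Bequest function of the fictitious monopoly for the terminal rule `φ`. -/
def bequest (ρ C c : ℝ) (φ : ℝ → ℝ) (x₀ x : ℝ) : ℝ :=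
  -C * (∫ w in x₀..x, Real.exp (-(ρ / G.r) * ∫ z in x₀..w, deriv φ z / G.e (φ z))) + c

end Oligopoly

/-! ### The single-agent problem -/

/-- A single-agent control problem `(ℓ, ρ, f, b)` with a scalar control. -/
structure Monopoly where
  ell : ℝ → ℝ
  ρ : ℝ
  f : ℝ → ℝ
  b : ℝ → ℝ

namespace Monopoly

variable (M : Monopoly)

/-- The data are of class `C²`. -/
def Smooth (U : Set ℝ) : Prop :=
  ContDiffOn ℝ 2 M.ell U ∧ ContDiffOn ℝ 2 M.f U ∧ ContDiffOn ℝ 2 M.b (Ioi 0)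

/-- `u` is an optimal feedback on `[0, T]`: it is admissible, and from every initial condition
`(t, x)` its payoff is at least that of every other feedback rule that has a trajectory there. -/
def IsOptimal (T : ℝ) (U : Set ℝ) (u : ℝ → ℝ → ℝ) : Prop :=
  Admissible M.f T U u ∧
    ∀ v, IsFeedback T U v → ∀ t ∈ Icc 0 T, ∀ x ∈ Ioi (0 : ℝ), ∀ z' z,
      IsTrajectory M.f v T t x z' → IsTrajectory M.f u T t x z →
      payoff M.ell M.ρ M.b v T t z' ≤ payoff M.ell M.ρ M.b u T t z

/-- `u` is an optimal stationary feedback on `[0, ∞)`. -/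
def IsStatOptimal (U : Set ℝ) (u : ℝ → ℝ) : Prop :=
  StatAdmissible M.f U u ∧
    ∀ x ∈ Ioi (0 : ℝ), ∀ z, IsStatTrajectory M.f u x z →
      StatConverges M.ell M.ρ u z ∧
      ∀ v, IsStatFeedback U v → ∀ z', IsStatTrajectory M.f v x z' →
        StatConverges M.ell M.ρ v z' →
        statPayoff M.ell M.ρ v z' ≤ statPayoff M.ell M.ρ u z

end Monopoly

end

/-!
A symmetric equilibrium and the optimal rule of the fictitious monopoly satisfy the same
quasilinear first-order equation `u_t + f(u) u_x = -r e₁(u)`. The proof derives this equation from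
the equilibrium property and then shows that it is sufficient for optimality in the monopoly.

*Necessity.* Let `y` be an equilibrium trajectory and `κ` a test function of the stock. The
perturbation `Ψ(y) = y + ε κ(y)` is a diffeomorphism of the state space for small `ε`, and player
`0` can, by a feedback rule (`deviation`), turn every equilibrium trajectory into its image under
`Ψ`. Such a deviation is admissible without any further theory of differential equations, since
its trajectories are exactly the images of the equilibrium trajectories
(`isTrajectory_deviation_iff`); it respects the control region because equilibrium rates are
interior and `κ` has compact support (`eventually_varied_mem`). The payoff along the perturbed
trajectory is an explicit function of `ε` with a maximum at `0`; differentiation and integration by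
parts (`integral_euler_eq_zero`) and the fundamental lemma of the calculus of variations give the
Euler equation, and dividing it by `∑_j L¹_{u¹u^j}` gives the equation above
(`IsMPNE.equation`, `IsStatMPNE.equation`).

*The monopoly.* Write `X = expFactor`, so that `X' = -(ρ/r) X / e₁` and `ℓ' = C f' X`. For the
costate `p = -C X(u)` the Hamiltonian `ℓ(v) + p f(v)` is maximal at `v = u` (`ell_sub_le`), because
`C f' ≥ 0` and `X` is antitone. The equation for `u` turns into `p_t + f(u) p_x = ρ p`.

*Finite horizon.* The latter identity says that `p` is the state derivative of a value function.
It is used in integrated form: for two trajectories `z`, `w` from a common point, interpolated by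
`z + θ (w - z)`, a pair of functions of `(s, θ)` has equal mixed derivatives, so Fubini's theorem
relates the payoff flows to `∫ p(T, ·)` between the terminal states (`integral_costate_eq`). As
`b' = -C X(φ) = p(T, ·)`, optimality follows.

*Infinite horizon.* The equation becomes `f(u) u' = -r e₁(u)`, so `f(u)` has no zero. It cannot be
positive, since the oligopoly would exhaust the stock in finite time (`f_neg_of_equation`), and `C`
cannot be positive, since the monopoly would (`const_nonpos_of_equation`). Hence the monopoly stock
tends to `0`. The discounted costate is constant along its trajectories (`exp_mul_expFactor_eq`);
it is a nonnegative multiplier for the total extraction, so a competing rule can gain at most this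
multiplier times the stock that `u` leaves in the ground, which vanishes in the limit.
-/

/-! ### Calculus preliminaries -/

theorem partialD_eq_fderiv {N : ℕ} {g : (Fin N → ℝ) → ℝ} {v : Fin N → ℝ}
    (hg : DifferentiableAt ℝ g v) (j : Fin N) :
    partialD j g v = fderiv ℝ g v (Pi.single j 1) := by
  have h1 : HasFDerivAt g (fderiv ℝ g v) (Function.update v j (v j)) := by
    simpa using hg.hasFDerivAt
  exact (h1.comp_hasDerivAt (v j) (hasDerivAt_update v j (v j))).deriv

theorem fderiv_apply_eq_sum_partialD {N : ℕ} {g : (Fin N → ℝ) → ℝ} {v : Fin N → ℝ}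
    (hg : DifferentiableAt ℝ g v) (w : Fin N → ℝ) :
    fderiv ℝ g v w = ∑ j, w j * partialD j g v := by
  conv_lhs => rw [pi_eq_sum_univ' w]
  simp only [map_sum, map_smul, smul_eq_mul]
  refine Finset.sum_congr rfl fun j _ => ?_
  rw [partialD_eq_fderiv hg j]

theorem contDiffOn_partialD {N : ℕ} {g : (Fin N → ℝ) → ℝ} {O : Set (Fin N → ℝ)} {n : WithTop ℕ∞}
    (hO : IsOpen O) (hg : ContDiffOn ℝ (n + 1) g O) (j : Fin N) :
    ContDiffOn ℝ n (partialD j g) O := by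
  have h1 : ContDiffOn ℝ n (fun v => fderiv ℝ g v (Pi.single j 1)) O :=
    (hg.fderiv_of_isOpen hO le_rfl).clm_apply contDiffOn_const
  refine h1.congr fun v hv => partialD_eq_fderiv ?_ j
  exact (hg.differentiableOn (by simp)).differentiableAt (hO.mem_nhds hv)

theorem contDiffOn_succ_of_hasDerivWithinAt {g g' : ℝ → ℝ} {s : Set ℝ} {n : ℕ}
    (hs : UniqueDiffOn ℝ s) (hg : ∀ x ∈ s, HasDerivWithinAt g (g' x) s x)
    (hg' : ContDiffOn ℝ n g' s) : ContDiffOn ℝ (n + 1) g s := by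
  rw [contDiffOn_succ_iff_derivWithin hs]
  refine ⟨fun x hx => (hg x hx).differentiableWithinAt, fun h => ?_, ?_⟩
  · exact absurd h (by simp)
  · exact hg'.congr fun x hx => (hg x hx).derivWithin (hs x hx)

/-- The fundamental theorem of calculus on an open interval, at every point and for every base
point of it. -/
theorem hasDerivAt_integral_of_continuousOn {g : ℝ → ℝ} {V : Set ℝ} (hV : IsOpen V)
    (hV' : V.OrdConnected) (hg : ContinuousOn g V) {a x : ℝ} (ha : a ∈ V) (hx : x ∈ V) :
    HasDerivAt (fun y => ∫ v in a..y, g v) (g x) x :=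
  intervalIntegral.integral_hasDerivAt_right
    ((hg.mono (hV'.uIcc_subset ha hx)).intervalIntegrable)
    (hg.stronglyMeasurableAtFilter hV x hx) (hg.continuousAt (hV.mem_nhds hx))

namespace Oligopoly

variable {N : ℕ} [NeZero N] (G : Oligopoly N)

/-! ### Marginal utilities on the diagonal -/

/-- Own marginal utility `L¹_{u¹}(u, …, u)`. -/
noncomputable def marginal (u : ℝ) : ℝ := partialD 0 (G.L 0) (fun _ => u)

/-- `∑_j L¹_{u¹ u^j}(u, …, u)`, which is the derivative of `marginal`. -/
noncomputable def marginalSlope (u : ℝ) : ℝ := ∑ j, partialD j (partialD 0 (G.L 0)) (fun _ => u)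

/-- `∑_{j ≠ 1} L¹_{u^j}(u, …, u)`, the marginal effect of the other players' common rate. -/
noncomputable def external (u : ℝ) : ℝ :=
  ∑ j ∈ Finset.univ.erase 0, partialD j (G.L 0) (fun _ => u)

theorem e_eq (u : ℝ) : G.e u = -(G.marginal u / G.marginalSlope u) := rfl

theorem f_eq (u : ℝ) :
    G.f u = -(N : ℝ) * u + ((N : ℝ) - 1) * G.e u + G.external u / G.marginalSlope u := by
  have h : ((N : ℝ) - 1) * G.eOther u = -(G.external u / G.marginalSlope u) := by
    change ((N : ℝ) - 1) * -(G.external u / (((N : ℝ) - 1) * G.marginalSlope u)) = _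
    by_cases hN : N = 1
    · subst hN
      simp [external]
    · have : (N : ℝ) - 1 ≠ 0 := sub_ne_zero.2 (by exact_mod_cast hN)
      rw [mul_neg, ← mul_div_assoc, mul_div_mul_left _ _ this]
  rw [f, mul_sub, h]
  ring

variable {G}

theorem Standard.e_pos (hG : G.Standard) {u : ℝ} (hu : u ∈ G.U) : 0 < G.e u :=
  hG.E_pos 0 _ fun _ => hu

theorem Standard.marginalSlope_ne_zero (hG : G.Standard) {u : ℝ} (hu : u ∈ G.U) :
    G.marginalSlope u ≠ 0 := by
  intro h
  have := hG.e_pos hu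
  rw [e_eq, h] at this
  simp at this

theorem Standard.exists_isOpen_continuousOn (hG : G.Standard) :
    ∃ D : Set ℝ, IsOpen D ∧ G.U ⊆ D ∧ ContinuousOn G.marginal D ∧
      ContinuousOn G.marginalSlope D ∧ ContinuousOn G.external D := by
  obtain ⟨O, hO, hUO, hL⟩ := hG.L_smooth
  have hcO : Continuous fun (u : ℝ) (_ : Fin N) => u := by fun_prop
  have h1 : ∀ j, ContDiffOn ℝ 1 (partialD j (G.L 0)) O := fun j =>
    contDiffOn_partialD hO (by simpa [one_add_one_eq_two] using hL 0) j
  have h2 : ∀ j, ContDiffOn ℝ 0 (partialD j (partialD 0 (G.L 0))) O := fun j =>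
    contDiffOn_partialD hO (by simpa using h1 0) j
  exact ⟨(fun (u : ℝ) (_ : Fin N) => u) ⁻¹' O, hO.preimage hcO, fun u hu => hUO fun _ => hu,
    (h1 0).continuousOn.comp hcO.continuousOn fun _ h => h,
    continuousOn_finsetSum _ fun j _ =>
      (h2 j).continuousOn.comp hcO.continuousOn fun _ h => h,
    continuousOn_finsetSum _ fun j _ =>
      (h1 j).continuousOn.comp hcO.continuousOn fun _ h => h⟩

theorem Standard.hasDerivAt_marginal (hG : G.Standard) {u : ℝ} (hu : u ∈ G.U) :
    HasDerivAt G.marginal (G.marginalSlope u) u := by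
  obtain ⟨O, hO, hUO, hL⟩ := hG.L_smooth
  have h1 : ContDiffOn ℝ 1 (partialD 0 (G.L 0)) O :=
    contDiffOn_partialD hO (by simpa [one_add_one_eq_two] using hL 0) 0
  have h2 : DifferentiableAt ℝ (partialD 0 (G.L 0)) (fun _ => u) :=
    (h1.differentiableOn (by norm_num)).differentiableAt (hO.mem_nhds (hUO fun _ => hu))
  have h3 : HasDerivAt (fun (u : ℝ) (_ : Fin N) => u) (fun _ => 1) u :=
    hasDerivAt_pi.2 fun _ => hasDerivAt_id u
  refine (h2.hasFDerivAt.comp_hasDerivAt u h3).congr_deriv ?_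
  rw [fderiv_apply_eq_sum_partialD h2]
  simp [marginalSlope]

/-- An open interval that contains the control region and on which `e` and `f` are continuous and
`e` is positive. Integrals of `e` and `f` over it may be differentiated on both sides of every
point, endpoints of the control region included. -/
structure RegularInterval (G : Oligopoly N) (V : Set ℝ) : Prop where
  isOpen : IsOpen V
  ordConnected : V.OrdConnected
  subset : G.U ⊆ V
  continuousOn_e : ContinuousOn G.e V
  continuousOn_f : ContinuousOn G.f V
  e_pos : ∀ v ∈ V, 0 < G.e v

theorem Standard.exists_regularInterval (hG : G.Standard) (hU : G.U.Nonempty) :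
    ∃ V : Set ℝ, G.RegularInterval V := by
  obtain ⟨D, hDo, hUO, cm, cs, cx⟩ := hG.exists_isOpen_continuousOn
  set D₁ : Set ℝ := D ∩ G.marginalSlope ⁻¹' {0}ᶜ
  have hD₁o : IsOpen D₁ := cs.isOpen_inter_preimage hDo isOpen_compl_singleton
  have ce : ContinuousOn G.e D₁ :=
    ((cm.mono inter_subset_left).div (cs.mono inter_subset_left) fun x hx => hx.2).neg
  have cf : ContinuousOn G.f D₁ := by
    have : ContinuousOn (fun u => -(N : ℝ) * u + ((N : ℝ) - 1) * G.e u +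
        G.external u / G.marginalSlope u) D₁ :=
      ((continuousOn_const.mul continuousOn_id).add (continuousOn_const.mul ce)).add
        ((cx.mono inter_subset_left).div (cs.mono inter_subset_left) fun x hx => hx.2)
    exact this.congr fun u _ => G.f_eq u
  set D₂ : Set ℝ := D₁ ∩ G.e ⁻¹' Ioi 0
  have hD₂o : IsOpen D₂ := ce.isOpen_inter_preimage hD₁o isOpen_Ioi
  have hUD : G.U ⊆ D₂ := fun u hu =>
    ⟨⟨hUO hu, hG.marginalSlope_ne_zero hu⟩, hG.e_pos hu⟩
  obtain ⟨u₀, hu₀⟩ := hU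
  have hsub : connectedComponentIn D₂ u₀ ⊆ D₂ := connectedComponentIn_subset _ _
  refine ⟨connectedComponentIn D₂ u₀, hD₂o.connectedComponentIn,
    isPreconnected_connectedComponentIn.ordConnected,
    hG.U_interval.isPreconnected.subset_connectedComponentIn hu₀ hUD,
    ce.mono (hsub.trans inter_subset_left), cf.mono (hsub.trans inter_subset_left),
    fun v hv => (hsub hv).2⟩

theorem RegularInterval.continuousOn_one_div_e {V : Set ℝ} (hV : G.RegularInterval V) :
    ContinuousOn (fun v => 1 / G.e v) V :=
  continuousOn_const.div hV.continuousOn_e fun v hv => (hV.e_pos v hv).ne'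

/-! ### The utility and the bequest of the fictitious monopoly -/

section Ell

variable {V : Set ℝ} (hV : G.RegularInterval V) {u₀ : ℝ} (hu₀ : u₀ ∈ V)

theorem expFactor_pos (ρ u₀ u : ℝ) : 0 < G.expFactor ρ u₀ u := Real.exp_pos _

include hV hu₀

theorem hasDerivAt_expFactor (ρ : ℝ) {u : ℝ} (hu : u ∈ V) :
    HasDerivAt (G.expFactor ρ u₀) (-(ρ / G.r) / G.e u * G.expFactor ρ u₀ u) u := by
  have h := hasDerivAt_integral_of_continuousOn hV.isOpen hV.ordConnected
    hV.continuousOn_one_div_e hu₀ hu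
  refine (h.const_mul (-(ρ / G.r))).exp.congr_deriv ?_
  change G.expFactor ρ u₀ u * _ = _
  ring

theorem continuousOn_expFactor (ρ : ℝ) : ContinuousOn (G.expFactor ρ u₀) V := fun _ hu =>
  (hasDerivAt_expFactor hV hu₀ ρ hu).continuousAt.continuousWithinAt

theorem contDiffOn_expFactor (ρ : ℝ) : ContDiffOn ℝ 1 (G.expFactor ρ u₀) V := by
  have : ContDiffOn ℝ ((0 : ℕ) + 1) (G.expFactor ρ u₀) V :=
    contDiffOn_succ_of_hasDerivWithinAt hV.isOpen.uniqueDiffOn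
      (fun u hu => (hasDerivAt_expFactor hV hu₀ ρ hu).hasDerivWithinAt)
      (contDiffOn_zero.2 ((continuousOn_const.div hV.continuousOn_e
        fun v hv => (hV.e_pos v hv).ne').mul (continuousOn_expFactor hV hu₀ ρ)))
  simpa using this

theorem antitoneOn_expFactor {ρ : ℝ} (hρ : 0 ≤ ρ) (hr : 0 < G.r) :
    AntitoneOn (G.expFactor ρ u₀) V := by
  refine antitoneOn_of_deriv_nonpos hV.ordConnected.convex (continuousOn_expFactor hV hu₀ ρ)
    (fun u hu => (hasDerivAt_expFactor hV hu₀ ρ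
      (interior_subset hu)).differentiableAt.differentiableWithinAt) fun u hu => ?_
  have hu := interior_subset hu
  rw [(hasDerivAt_expFactor hV hu₀ ρ hu).deriv]
  have := hV.e_pos u hu
  have : 0 ≤ (ρ / G.r) / G.e u * G.expFactor ρ u₀ u := by
    have := expFactor_pos (G := G) ρ u₀ u
    positivity
  rw [neg_div, neg_mul]
  linarith

/-- The antiderivative in `ell`. Up to the factor `C ρ / r` and an additive constant it is the
maximized Hamiltonian `ℓ(u) - C f(u) X(u)`. -/
theorem hasDerivAt_integral_expFactor (ρ : ℝ) {u : ℝ} (hu : u ∈ V) :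
    HasDerivAt (fun u => ∫ v in u₀..u, G.f v / G.e v * G.expFactor ρ u₀ v)
      (G.f u / G.e u * G.expFactor ρ u₀ u) u :=
  hasDerivAt_integral_of_continuousOn hV.isOpen hV.ordConnected
    ((hV.continuousOn_f.div hV.continuousOn_e fun v hv => (hV.e_pos v hv).ne').mul
      (continuousOn_expFactor hV hu₀ ρ)) hu₀ hu

theorem hasDerivWithinAt_ell (hf : DifferentiableOn ℝ G.f G.U) (ρ C c : ℝ) {u : ℝ} (hu : u ∈ G.U) :
    HasDerivWithinAt (G.ell ρ C c u₀)
      (C * derivWithin G.f G.U u * G.expFactor ρ u₀ u) G.U u := by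
  have h1 := (hf u hu).hasDerivWithinAt
  have h2 := (hasDerivAt_expFactor hV hu₀ ρ (hV.subset hu)).hasDerivWithinAt (s := G.U)
  have h3 := (hasDerivAt_integral_expFactor hV hu₀ ρ
    (hV.subset hu)).hasDerivWithinAt (s := G.U)
  refine ((((h1.const_mul C).mul h2).add (h3.const_mul (C * (ρ / G.r)))).add_const c).congr_deriv ?_
  ring

theorem contDiffOn_ell (hU : UniqueDiffOn ℝ G.U)
    (hf : ContDiffOn ℝ 2 G.f G.U) (ρ C c : ℝ) : ContDiffOn ℝ 2 (G.ell ρ C c u₀) G.U := by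
  have h2 : ContDiffOn ℝ 1 (derivWithin G.f G.U) G.U := hf.derivWithin hU (by norm_num)
  have h1 := (contDiffOn_const (c := C)).mul h2 |>.mul
    ((contDiffOn_expFactor hV hu₀ ρ).mono hV.subset)
  have h3 : ContDiffOn ℝ ((1 : ℕ) + 1) (G.ell ρ C c u₀) G.U :=
    contDiffOn_succ_of_hasDerivWithinAt hU (fun u hu =>
      hasDerivWithinAt_ell hV hu₀ (hf.differentiableOn (by norm_num)) ρ C c hu)
      (by simpa using h1)
  simpa [one_add_one_eq_two] using h3

/-- The maximum condition: with the costate `-C X(u)`, the Hamiltonian `ℓ(v) - C X(u) f(v)` of the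
fictitious monopoly is maximal at `v = u`, since its derivative is `C f'(v) (X(v) - X(u))` and `X`
is antitone. -/
theorem ell_sub_le (hG : G.Standard) (hf : DifferentiableOn ℝ G.f G.U) {ρ C : ℝ} (hρ : 0 ≤ ρ)
    (hC : ∀ u ∈ G.U, 0 ≤ C * derivWithin G.f G.U u) (c : ℝ) {u v : ℝ} (hu : u ∈ G.U)
    (hv : v ∈ G.U) :
    G.ell ρ C c u₀ v - G.ell ρ C c u₀ u ≤ C * G.expFactor ρ u₀ u * (G.f v - G.f u) := by
  have hd : ∀ w ∈ G.U, HasDerivWithinAt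
      (fun v => G.ell ρ C c u₀ v - C * G.expFactor ρ u₀ u * G.f v)
      (C * derivWithin G.f G.U w * (G.expFactor ρ u₀ w - G.expFactor ρ u₀ u)) G.U w := by
    intro w hw
    refine ((hasDerivWithinAt_ell hV hu₀ hf ρ C c hw).sub
      ((hf w hw).hasDerivWithinAt.const_mul (C * G.expFactor ρ u₀ u))).congr_deriv ?_
    ring
  have hX := antitoneOn_expFactor hV hu₀ hρ hG.r_pos
  have key : G.ell ρ C c u₀ v - C * G.expFactor ρ u₀ u * G.f v ≤
      G.ell ρ C c u₀ u - C * G.expFactor ρ u₀ u * G.f u := by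
    rcases le_total v u with h | h
    · have hsub : Icc v u ⊆ G.U := hG.U_interval.out hv hu
      refine (monotoneOn_of_hasDerivWithinAt_nonneg (convex_Icc v u)
        (fun w hw => ((hd w (hsub hw)).continuousWithinAt.mono hsub)) (fun w hw =>
        (hd w (hsub (interior_subset hw))).mono (interior_subset.trans hsub)) fun w hw => ?_)
        (left_mem_Icc.2 h) (right_mem_Icc.2 h) h
      have hw := interior_subset hw
      exact mul_nonneg (hC w (hsub hw)) (sub_nonneg.2 (hX (hV.subset (hsub hw)) (hV.subset hu) hw.2))
    · have hsub : Icc u v ⊆ G.U := hG.U_interval.out hu hv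
      refine (antitoneOn_of_hasDerivWithinAt_nonpos (convex_Icc u v)
        (fun w hw => ((hd w (hsub hw)).continuousWithinAt.mono hsub)) (fun w hw =>
        (hd w (hsub (interior_subset hw))).mono (interior_subset.trans hsub)) fun w hw => ?_)
        (left_mem_Icc.2 h) (right_mem_Icc.2 h) h
      have hw := interior_subset hw
      exact mul_nonpos_of_nonneg_of_nonpos (hC w (hsub hw))
        (sub_nonpos.2 (hX (hV.subset hu) (hV.subset (hsub hw)) hw.1))
  linarith

end Ell

section Bequest

variable {V : Set ℝ} (hV : G.RegularInterval V) {φ : ℝ → ℝ} (hφ : ContDiffOn ℝ 1 φ (Ioi 0))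
  (hφV : ∀ x ∈ Ioi (0 : ℝ), φ x ∈ V) {x₀ : ℝ} (hx₀ : x₀ ∈ Ioi (0 : ℝ))

include hV hφ hφV hx₀

/-- The exponential in the bequest is `X(φ(x))`, by the substitution `v = φ(z)`. -/
theorem exp_integral_eq_expFactor (ρ : ℝ) {x : ℝ} (hx : x ∈ Ioi (0 : ℝ)) :
    Real.exp (-(ρ / G.r) * ∫ z in x₀..x, deriv φ z / G.e (φ z)) =
      G.expFactor ρ (φ x₀) (φ x) := by
  have hsub : uIcc x₀ x ⊆ Ioi 0 := ordConnected_Ioi.uIcc_subset hx₀ hx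
  have hd : ∀ z ∈ Ioi (0 : ℝ), HasDerivAt φ (deriv φ z) z := fun z hz =>
    ((hφ.differentiableOn (by norm_num)).differentiableAt (isOpen_Ioi.mem_nhds hz)).hasDerivAt
  have hc : ContinuousOn (deriv φ) (Ioi 0) := hφ.continuousOn_deriv_of_isOpen isOpen_Ioi le_rfl
  have h := intervalIntegral.integral_eq_sub_of_hasDerivAt (a := x₀) (b := x)
    (f := fun z => ∫ v in φ x₀..φ z, 1 / G.e v) (f' := fun z => deriv φ z / G.e (φ z))
    (fun z hz => by
      have h1 := (hasDerivAt_integral_of_continuousOn hV.isOpen hV.ordConnected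
        hV.continuousOn_one_div_e (hφV x₀ hx₀) (hφV z (hsub hz))).comp z
          (hd z (hsub hz))
      exact h1.congr_deriv (by ring))
    ((hc.mono hsub).div
      (hV.continuousOn_e.comp (hφ.continuousOn.mono hsub) fun z hz => hφV z (hsub hz))
      fun z hz => (hV.e_pos _ (hφV z (hsub hz))).ne').intervalIntegrable
  rw [h, expFactor]
  simp

theorem hasDerivAt_bequest (ρ C c : ℝ) {x : ℝ} (hx : x ∈ Ioi (0 : ℝ)) :
    HasDerivAt (G.bequest ρ C c φ x₀) (-C * G.expFactor ρ (φ x₀) (φ x)) x := by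
  have hX : ContinuousOn (fun x => Real.exp (-(ρ / G.r) * ∫ z in x₀..x, deriv φ z / G.e (φ z)))
      (Ioi 0) := by
    refine ContinuousOn.congr ?_ fun x hx =>
      exp_integral_eq_expFactor hV hφ hφV hx₀ ρ hx
    exact (continuousOn_expFactor hV (hφV x₀ hx₀) ρ).comp hφ.continuousOn hφV
  have h := ((hasDerivAt_integral_of_continuousOn isOpen_Ioi ordConnected_Ioi hX hx₀
    hx).const_mul (-C)).add_const c
  rwa [exp_integral_eq_expFactor hV hφ hφV hx₀ ρ hx] at h

theorem contDiffOn_bequest (ρ C c : ℝ) :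
    ContDiffOn ℝ 2 (G.bequest ρ C c φ x₀) (Ioi 0) := by
  have h2 : ContDiffOn ℝ ((1 : ℕ) + 1) (G.bequest ρ C c φ x₀) (Ioi 0) :=
    contDiffOn_succ_of_hasDerivWithinAt isOpen_Ioi.uniqueDiffOn (fun x hx =>
      (hasDerivAt_bequest hV hφ hφV hx₀ ρ C c hx).hasDerivWithinAt)
      (contDiffOn_const.mul ((contDiffOn_expFactor hV (hφV x₀ hx₀) ρ).comp hφ hφV))
  simpa [one_add_one_eq_two] using h2

end Bequest

/-! ### The sign of `f'` -/

theorem Standard.uniqueDiffOn (hG : G.Standard) (hf' : ∀ u ∈ G.U, derivWithin G.f G.U u ≠ 0) :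
    UniqueDiffOn ℝ G.U := by
  rcases G.U.subsingleton_or_nontrivial with h | h
  · intro u hu
    refine absurd ?_ (hf' u hu)
    rw [h.eq_singleton_of_mem hu]
    exact derivWithin_zero_of_not_accPt fun h => by simpa using (accPt_iff_frequently.1 h).exists
  · exact uniqueDiffOn_convex hG.U_interval.convex
      ((hG.U_interval.convex.nontrivial_iff_nonempty_interior).1 h)

theorem Standard.exists_sign (hG : G.Standard) (hf : ContDiffOn ℝ 2 G.f G.U)
    (hf' : ∀ u ∈ G.U, derivWithin G.f G.U u ≠ 0) :
    ∃ C : ℝ, C ≠ 0 ∧ ∀ u ∈ G.U, 0 ≤ C * derivWithin G.f G.U u := by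
  have hc : ContinuousOn (derivWithin G.f G.U) G.U :=
    hf.continuousOn_derivWithin (hG.uniqueDiffOn hf') (by norm_num)
  by_cases h : ∃ u ∈ G.U, 0 < derivWithin G.f G.U u
  · obtain ⟨u, hu, hpos⟩ := h
    refine ⟨1, one_ne_zero, fun v hv => ?_⟩
    by_contra! hneg
    rw [one_mul] at hneg
    obtain ⟨w, hw, h0⟩ := hG.U_interval.isPreconnected.intermediate_value hv hu hc
      ⟨hneg.le, hpos.le⟩
    exact hf' w hw h0
  · push Not at h
    exact ⟨-1, by norm_num, fun u hu => by linarith [h u hu]⟩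

end Oligopoly

/-! ### Changes of the state variable -/

/-- A `C²` diffeomorphism `Ψ` of the line with inverse `Λ` that maps `(0, ∞)` onto itself. -/
structure IsStateChange (Ψ Λ : ℝ → ℝ) : Prop where
  contDiff : ContDiff ℝ 2 Ψ
  contDiff_inv : ContDiff ℝ 2 Λ
  left_inv : Function.LeftInverse Λ Ψ
  right_inv : Function.RightInverse Λ Ψ
  pos_iff : ∀ y, 0 < Ψ y ↔ 0 < y

namespace IsStateChange

variable {Ψ Λ : ℝ → ℝ} (h : IsStateChange Ψ Λ)

include h

theorem inv_pos_iff (z : ℝ) : 0 < Λ z ↔ 0 < z := by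
  rw [← h.pos_iff, h.right_inv]

theorem hasDerivAt (y : ℝ) : HasDerivAt Ψ (deriv Ψ y) y :=
  (h.contDiff.differentiable (by norm_num) y).hasDerivAt

theorem hasDerivAt_inv (z : ℝ) : HasDerivAt Λ (deriv Λ z) z :=
  (h.contDiff_inv.differentiable (by norm_num) z).hasDerivAt

theorem deriv_inv_mul_deriv (z : ℝ) : deriv Λ z * deriv Ψ (Λ z) = 1 := by
  have h1 : HasDerivAt (Λ ∘ Ψ) (deriv Λ (Ψ (Λ z)) * deriv Ψ (Λ z)) (Λ z) :=
    (h.hasDerivAt_inv _).comp _ (h.hasDerivAt _)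
  rw [h.left_inv.comp_eq_id, h.right_inv] at h1
  exact h1.unique (hasDerivAt_id _)

end IsStateChange

/-- A compactly supported perturbation of the identity with positive derivative is a change of the
state variable. -/
theorem exists_isStateChange_add_mul {κ : ℝ → ℝ} (hκ : ContDiff ℝ 2 κ) (hκc : HasCompactSupport κ)
    (hκ0 : κ 0 = 0) {ε : ℝ} (hε : ∀ y, 0 < 1 + ε * deriv κ y) :
    ∃ Λ, IsStateChange (fun y => y + ε * κ y) Λ := by
  have hd : ∀ y, HasDerivAt (fun y => y + ε * κ y) (1 + ε * deriv κ y) y := fun y =>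
    (hasDerivAt_id y).add ((hκ.differentiable (by norm_num) y).hasDerivAt.const_mul ε)
  have hmono : StrictMono fun y => y + ε * κ y := strictMono_of_deriv_pos fun y => by
    rw [(hd y).deriv]; exact hε y
  have hsmooth : ContDiff ℝ 2 fun y => y + ε * κ y := contDiff_id.add (contDiff_const.mul hκ)
  obtain ⟨M, hM⟩ := hκc.exists_bound_of_continuous hκ.continuous
  have hM' : ∀ y, |ε * κ y| ≤ |ε| * M := fun y => by
    rw [abs_mul]; exact mul_le_mul_of_nonneg_left (hM y) (abs_nonneg _)
  have hsurj : Function.Surjective fun y => y + ε * κ y :=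
    hsmooth.continuous.surjective
      (Filter.tendsto_atTop_add_right_of_le _ (-(|ε| * M)) Filter.tendsto_id
        fun y => (abs_le.1 (hM' y)).1)
      (Filter.tendsto_atBot_add_right_of_ge _ (|ε| * M) Filter.tendsto_id
        fun y => (abs_le.1 (hM' y)).2)
  set H := (hmono.orderIsoOfSurjective _ hsurj).toHomeomorph with hH
  refine ⟨H.symm, hsmooth, H.contDiff_symm_deriv (fun y => (hε y).ne') hd hsmooth,
    H.symm_apply_apply, H.apply_symm_apply, fun y => ?_⟩
  have := hmono.lt_iff_lt (a := 0) (b := y)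
  simpa [hκ0] using this

/-! ### Rules with partial derivatives -/

/-- `ut` and `ux` are the continuous partial derivatives of the rule `u` on `[0, T] × (0, ∞)`. -/
structure HasPartials (T : ℝ) (u ut ux : ℝ → ℝ → ℝ) : Prop where
  hasFDerivWithinAt : ∀ t ∈ Icc 0 T, ∀ x ∈ Ioi (0 : ℝ),
    HasFDerivWithinAt (fun q : ℝ × ℝ => u q.1 q.2)
      (ut t x • ContinuousLinearMap.fst ℝ ℝ ℝ + ux t x • ContinuousLinearMap.snd ℝ ℝ ℝ)
      (Icc 0 T ×ˢ Ioi 0) (t, x)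
  continuousOn_time : ContinuousOn (fun q : ℝ × ℝ => ut q.1 q.2) (Icc 0 T ×ˢ Ioi 0)
  continuousOn_state : ContinuousOn (fun q : ℝ × ℝ => ux q.1 q.2) (Icc 0 T ×ˢ Ioi 0)

theorem uniqueDiffOn_Icc_prod_Ioi {T : ℝ} (hT : 0 < T) :
    UniqueDiffOn ℝ (Icc 0 T ×ˢ Ioi (0 : ℝ)) :=
  (uniqueDiffOn_Icc hT).prod isOpen_Ioi.uniqueDiffOn

theorem exists_hasPartials {T : ℝ} (hT : 0 < T) {u : ℝ → ℝ → ℝ}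
    (hu : ContDiffOn ℝ 1 (fun q : ℝ × ℝ => u q.1 q.2) (Icc 0 T ×ˢ Ioi 0)) :
    ∃ ut ux, HasPartials T u ut ux := by
  have hc := hu.continuousOn_fderivWithin (uniqueDiffOn_Icc_prod_Ioi hT) le_rfl
  refine ⟨fun t x => fderivWithin ℝ (fun q : ℝ × ℝ => u q.1 q.2) (Icc 0 T ×ˢ Ioi 0) (t, x) (1, 0),
    fun t x => fderivWithin ℝ (fun q : ℝ × ℝ => u q.1 q.2) (Icc 0 T ×ˢ Ioi 0) (t, x) (0, 1),
    fun t ht x hx => ?_, hc.clm_apply continuousOn_const, hc.clm_apply continuousOn_const⟩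
  refine ((hu.differentiableOn (by norm_num)) (t, x) ⟨ht, hx⟩).hasFDerivWithinAt.congr_fderiv ?_
  ext <;> simp

theorem hasPartials_of_stationary {T : ℝ} {u : ℝ → ℝ} (hu : ContDiffOn ℝ 1 u (Ioi 0)) :
    HasPartials T (fun _ => u) (fun _ _ => 0) (fun _ => deriv u) where
  hasFDerivWithinAt t _ x hx := by
    have h1 : HasDerivAt u (deriv u x) x :=
      ((hu.differentiableOn (by norm_num)).differentiableAt (isOpen_Ioi.mem_nhds hx)).hasDerivAt
    have h2 : HasFDerivAt (fun q : ℝ × ℝ => u q.2) (deriv u x • ContinuousLinearMap.snd ℝ ℝ ℝ)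
      (t, x) := h1.comp_hasFDerivAt (t, x) hasFDerivAt_snd
    simpa using h2.hasFDerivWithinAt
  continuousOn_time := continuousOn_const
  continuousOn_state := (hu.continuousOn_deriv_of_isOpen isOpen_Ioi le_rfl).comp continuousOn_snd
    fun _ hq => hq.2

namespace HasPartials

variable {T : ℝ} {u ut ux : ℝ → ℝ → ℝ} (h : HasPartials T u ut ux)

include h

theorem continuousOn : ContinuousOn (fun q : ℝ × ℝ => u q.1 q.2) (Icc 0 T ×ˢ Ioi 0) :=
  fun q hq => (h.hasFDerivWithinAt q.1 hq.1 q.2 hq.2).continuousWithinAt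

theorem hasDerivAt_state {t x : ℝ} (ht : t ∈ Icc 0 T) (hx : x ∈ Ioi (0 : ℝ)) :
    HasDerivAt (u t) (ux t x) x := by
  have h1 : HasDerivWithinAt (fun ξ : ℝ => (t, ξ)) ((0 : ℝ), (1 : ℝ)) (Ioi 0) x :=
    ((hasDerivAt_const x t).prodMk (hasDerivAt_id x)).hasDerivWithinAt
  have h2 := (h.hasFDerivWithinAt t ht x hx).comp_hasDerivWithinAt x h1 fun ξ hξ => ⟨ht, hξ⟩
  simpa [Function.comp_def] using h2.hasDerivAt (isOpen_Ioi.mem_nhds hx)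

theorem hasDerivWithinAt_comp {S : Set ℝ} {y : ℝ → ℝ} {y' s : ℝ} (hs : s ∈ S)
    (hS : ∀ τ ∈ S, τ ∈ Icc 0 T ∧ y τ ∈ Ioi 0) (hy : HasDerivWithinAt y y' S s) :
    HasDerivWithinAt (fun τ => u τ (y τ)) (ut s (y s) + ux s (y s) * y') S s := by
  have h1 := (hasDerivWithinAt_id s S).prodMk hy
  have h2 := (h.hasFDerivWithinAt s (hS s hs).1 (y s) (hS s hs).2).comp_hasDerivWithinAt s h1
    fun τ hτ => hS τ hτ
  simpa [Function.comp_def] using h2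

end HasPartials

/-! ### Deviations by a change of the state variable -/

namespace Oligopoly

/-- The rate of player `0` which, when the others keep playing `u`, turns every equilibrium
trajectory `y` into the trajectory `Ψ ∘ y`. -/
noncomputable def deviation (N : ℕ) (Ψ Λ u : ℝ → ℝ) (z : ℝ) : ℝ :=
  N * (u (Λ z) * deriv Ψ (Λ z)) - ((N : ℝ) - 1) * u z

variable {N : ℕ} [NeZero N]

/-- The profile in which player `0` chooses `w` and all others choose `a`. -/
def oneAgainst (N : ℕ) [NeZero N] (a w : ℝ) : Fin N → ℝ :=
  Function.update (fun _ => a) 0 w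

theorem oneAgainst_self (a : ℝ) : oneAgainst N a a = fun _ => a := by
  simp [oneAgainst]

theorem oneAgainst_zero (a w : ℝ) : oneAgainst N a w 0 = w := by
  simp [oneAgainst]

theorem oneAgainst_of_ne {j : Fin N} (hj : j ≠ 0) (a w : ℝ) : oneAgainst N a w j = a := by
  simp [oneAgainst, hj]

theorem sum_oneAgainst_mul (a w : ℝ) (g : Fin N → ℝ) :
    ∑ j, oneAgainst N a w j * g j = w * g 0 + a * ∑ j ∈ Finset.univ.erase 0, g j := by
  rw [← Finset.add_sum_erase _ _ (Finset.mem_univ (0 : Fin N)), oneAgainst_zero, Finset.mul_sum]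
  congr 1
  refine Finset.sum_congr rfl fun j hj => ?_
  rw [oneAgainst_of_ne (Finset.ne_of_mem_erase hj)]

theorem dyn_oneAgainst (a w : ℝ) : dyn (oneAgainst N a w) = -(w + ((N : ℝ) - 1) * a) := by
  have := sum_oneAgainst_mul (N := N) a w fun _ => 1
  simp only [mul_one, Finset.sum_const, nsmul_eq_mul, Finset.card_erase_of_mem (Finset.mem_univ _),
    Finset.card_univ, Fintype.card_fin, Nat.cast_pred (NeZero.pos N)] at this
  rw [dyn, this]
  ring

theorem dyn_const {N : ℕ} (a : ℝ) : dyn (fun _ : Fin N => a) = -(N : ℝ) * a := by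
  simp [dyn]

theorem dyn_deviation (Ψ Λ u : ℝ → ℝ) (z : ℝ) :
    dyn (oneAgainst N (u z) (deviation N Ψ Λ u z)) = -(N : ℝ) * u (Λ z) * deriv Ψ (Λ z) := by
  rw [dyn_oneAgainst, deviation]
  ring

section Deviation

variable {Ψ Λ : ℝ → ℝ} (h : IsStateChange Ψ Λ)

include h

/-- Under the deviation the total rate is `N u(Λ z) Ψ'(Λ z)`, which is the velocity of the image
under `Ψ` of an equilibrium trajectory. -/
theorem hasDerivWithinAt_deviation_iff {u z : ℝ → ℝ} {S : Set ℝ} {s : ℝ} :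
    HasDerivWithinAt z (dyn (oneAgainst N (u (z s)) (deviation N Ψ Λ u (z s)))) S s ↔
      HasDerivWithinAt (fun τ => Λ (z τ)) (dyn fun _ : Fin N => u (Λ (z s))) S s := by
  rw [dyn_deviation, dyn_const]
  constructor
  · intro hz
    refine ((h.hasDerivAt_inv _).comp_hasDerivWithinAt s hz).congr_deriv ?_
    linear_combination (-(N : ℝ) * u (Λ (z s))) * h.deriv_inv_mul_deriv (z s)
  · intro hz
    have := (h.hasDerivAt _).comp_hasDerivWithinAt s hz
    refine (this.congr_deriv (by ring)).congr_of_eventuallyEq ?_ ?_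
    · exact Filter.Eventually.of_forall fun τ => (h.right_inv _).symm
    · exact (h.right_inv _).symm

theorem isTrajectory_deviation_iff {u : ℝ → ℝ → ℝ} {T t x : ℝ} {z : ℝ → ℝ} :
    IsTrajectory dyn (fun s ξ => oneAgainst N (u s ξ) (deviation N Ψ Λ (u s) ξ)) T t x z ↔
      IsTrajectory dyn (fun s ξ (_ : Fin N) => u s ξ) T t (Λ x) (fun s => Λ (z s)) := by
  simp only [IsTrajectory, hasDerivWithinAt_deviation_iff h, h.inv_pos_iff,
    h.right_inv.injective.eq_iff]

theorem isStatTrajectory_deviation_iff {u : ℝ → ℝ} {x : ℝ} {z : ℝ → ℝ} :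
    IsStatTrajectory dyn (fun ξ => oneAgainst N (u ξ) (deviation N Ψ Λ u ξ)) x z ↔
      IsStatTrajectory dyn (fun ξ (_ : Fin N) => u ξ) (Λ x) (fun s => Λ (z s)) := by
  simp only [IsStatTrajectory, hasDerivWithinAt_deviation_iff h, h.inv_pos_iff,
    h.right_inv.injective.eq_iff]

theorem contDiffOn_deviation {T : ℝ} {u : ℝ → ℝ → ℝ}
    (hu : ContDiffOn ℝ 1 (fun q : ℝ × ℝ => u q.1 q.2) (Icc 0 T ×ˢ Ioi 0)) :
    ContDiffOn ℝ 1 (fun q : ℝ × ℝ => oneAgainst N (u q.1 q.2) (deviation N Ψ Λ (u q.1) q.2))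
      (Icc 0 T ×ˢ Ioi 0) := by
  have hΛ : ContDiff ℝ 1 Λ := h.contDiff_inv.of_le (by norm_num)
  have hΨ' : ContDiff ℝ 1 (deriv Ψ) := ((contDiff_succ_iff_deriv (n := 1)).1
    (by simpa [one_add_one_eq_two] using h.contDiff)).2.2
  have h1 : ContDiffOn ℝ 1 (fun q : ℝ × ℝ => u q.1 (Λ q.2)) (Icc 0 T ×ˢ Ioi 0) :=
    hu.comp (contDiff_fst.prodMk (hΛ.comp contDiff_snd)).contDiffOn
      fun q hq => ⟨hq.1, (h.inv_pos_iff _).2 hq.2⟩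
  have h2 : ContDiffOn ℝ 1 (fun q : ℝ × ℝ => deviation N Ψ Λ (u q.1) q.2) (Icc 0 T ×ˢ Ioi 0) :=
    (contDiffOn_const.mul (h1.mul (hΨ'.comp (hΛ.comp contDiff_snd)).contDiffOn)).sub
      (contDiffOn_const.mul hu)
  refine contDiffOn_pi.2 fun j => ?_
  by_cases hj : j = 0
  · subst hj
    simpa only [oneAgainst_zero] using h2
  · simpa only [oneAgainst_of_ne hj] using hu

theorem admissible_deviation {G : Oligopoly N} {T : ℝ} {u : ℝ → ℝ → ℝ}
    (hu : Admissible dyn T G.profiles (fun t x _ => u t x))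
    (hmem : ∀ t ∈ Icc 0 T, ∀ x ∈ Ioi (0 : ℝ), deviation N Ψ Λ (u t) x ∈ G.U) :
    Admissible dyn T G.profiles
      (fun t x => oneAgainst N (u t x) (deviation N Ψ Λ (u t) x)) := by
  obtain ⟨⟨hc, hU⟩, htraj⟩ := hu
  refine ⟨⟨contDiffOn_deviation h (contDiffOn_pi.1 hc 0), fun t ht x hx j => ?_⟩,
    fun t ht x hx => ?_⟩
  · by_cases hj : j = 0
    · subst hj
      simpa only [oneAgainst_zero] using hmem t ht x hx
    · simpa only [oneAgainst_of_ne hj] using hU t ht x hx j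
  · obtain ⟨⟨y, hy⟩, huniq⟩ := htraj t ht (Λ x) ((h.inv_pos_iff x).2 hx)
    refine ⟨⟨fun s => Ψ (y s), ?_⟩, fun y₁ y₂ h₁ h₂ s hs => ?_⟩
    · rw [isTrajectory_deviation_iff h]
      simpa only [h.left_inv _] using hy
    · exact h.right_inv.injective (huniq _ _ ((isTrajectory_deviation_iff h).1 h₁)
        ((isTrajectory_deviation_iff h).1 h₂) hs)

theorem statAdmissible_deviation {G : Oligopoly N} {u : ℝ → ℝ}
    (hu : StatAdmissible dyn G.profiles (fun x _ => u x))
    (hmem : ∀ x ∈ Ioi (0 : ℝ), deviation N Ψ Λ u x ∈ G.U) :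
    StatAdmissible dyn G.profiles (fun x => oneAgainst N (u x) (deviation N Ψ Λ u x)) := by
  obtain ⟨⟨hc, hU⟩, htraj⟩ := hu
  refine ⟨⟨?_, fun x hx j => ?_⟩, fun x hx => ?_⟩
  · have h1 : ContDiffOn ℝ 1 (fun q : ℝ × ℝ => u q.2) (Icc 0 1 ×ˢ Ioi 0) :=
      (contDiffOn_pi.1 hc 0).comp contDiff_snd.contDiffOn fun q hq => hq.2
    exact (contDiffOn_deviation (N := N) (u := fun _ => u) h h1).comp (g := fun q : ℝ × ℝ =>
      oneAgainst N (u q.2) (deviation N Ψ Λ u q.2)) (f := fun x : ℝ => ((0 : ℝ), x))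
      (contDiff_const.prodMk contDiff_id).contDiffOn fun x hx => ⟨by simp, hx⟩
  · by_cases hj : j = 0
    · subst hj
      simpa only [oneAgainst_zero] using hmem x hx
    · simpa only [oneAgainst_of_ne hj] using hU x hx j
  · obtain ⟨⟨y, hy⟩, huniq⟩ := htraj (Λ x) ((h.inv_pos_iff x).2 hx)
    refine ⟨⟨fun s => Ψ (y s), ?_⟩, fun y₁ y₂ h₁ h₂ s hs => ?_⟩
    · rw [isStatTrajectory_deviation_iff h]
      simpa only [h.left_inv _] using hy
    · exact h.right_inv.injective (huniq _ _ ((isStatTrajectory_deviation_iff h).1 h₁)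
        ((isStatTrajectory_deviation_iff h).1 h₂) hs)

end Deviation

end Oligopoly

/-! ### The first variation of the payoff -/

theorem hasDerivAt_integral_of_continuousOn_deriv {ψ ψ' : ℝ → ℝ → ℝ} {a b δ : ℝ} (hab : a ≤ b)
    (hδ : 0 < δ) (hψ : ∀ ε ∈ Ioo (-δ) δ, ContinuousOn (ψ ε) (Icc a b))
    (hd : ∀ ε ∈ Ioo (-δ) δ, ∀ s ∈ Icc a b, HasDerivAt (fun ε => ψ ε s) (ψ' ε s) ε)
    (hc : ContinuousOn (fun q : ℝ × ℝ => ψ' q.1 q.2) (Ioo (-δ) δ ×ˢ Icc a b)) :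
    HasDerivAt (fun ε => ∫ s in a..b, ψ ε s) (∫ s in a..b, ψ' 0 s) 0 := by
  have hδ' : Icc (-(δ / 2)) (δ / 2) ⊆ Ioo (-δ) δ := fun ε hε =>
    ⟨by linarith [hε.1], by linarith [hε.2]⟩
  have h0 : (0 : ℝ) ∈ Ioo (-δ) δ := ⟨by linarith, hδ⟩
  obtain ⟨M, hM⟩ := (isCompact_Icc.prod isCompact_Icc).exists_bound_of_continuousOn
    (hc.mono (prod_mono hδ' (Subset.refl (Icc a b))))
  have hI : uIoc a b ⊆ Icc a b := by
    rw [uIoc_of_le hab]; exact Ioc_subset_Icc_self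
  have hI' : uIcc a b = Icc a b := uIcc_of_le hab
  have hc0 : ContinuousOn (ψ' 0) (Icc a b) :=
    hc.comp (f := fun s => ((0 : ℝ), s)) (by fun_prop) fun s hs => ⟨h0, hs⟩
  refine (intervalIntegral.hasDerivAt_integral_of_dominated_loc_of_deriv_le (bound := fun _ => M)
    (s := Icc (-(δ / 2)) (δ / 2))
    (Icc_mem_nhds (by linarith) (by linarith)) ?_ ?_ ?_ ?_ ?_ ?_).2
  · filter_upwards [Ioo_mem_nhds h0.1 h0.2] with ε hε
    exact ((hI' ▸ hψ ε hε).intervalIntegrable).def'.aestronglyMeasurable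
  · exact (hI' ▸ hψ 0 h0).intervalIntegrable
  · exact ((hI' ▸ hc0).intervalIntegrable).def'.aestronglyMeasurable
  · exact Filter.Eventually.of_forall fun s hs ε hε => hM (ε, s) ⟨hε, hI hs⟩
  · exact intervalIntegrable_const
  · exact Filter.Eventually.of_forall fun s hs ε hε => hd ε (hδ' hε) s (hI hs)

namespace Oligopoly

variable {N : ℕ} [NeZero N]

theorem hasDerivAt_oneAgainst {a w : ℝ → ℝ} {a' w' ε : ℝ} (ha : HasDerivAt a a' ε)
    (hw : HasDerivAt w w' ε) :
    HasDerivAt (fun ε => oneAgainst N (a ε) (w ε)) (oneAgainst N a' w') ε := by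
  refine hasDerivAt_pi.2 fun j => ?_
  by_cases hj : j = 0
  · subst hj
    simpa only [oneAgainst_zero] using hw
  · simpa only [oneAgainst_of_ne hj] using ha

theorem continuousOn_oneAgainst {X : Type*} [TopologicalSpace X] {a w : X → ℝ} {S : Set X}
    (ha : ContinuousOn a S) (hw : ContinuousOn w S) :
    ContinuousOn (fun q => oneAgainst N (a q) (w q)) S := by
  refine continuousOn_pi.2 fun j => ?_
  by_cases hj : j = 0
  · subst hj
    simpa only [oneAgainst_zero] using hw
  · simpa only [oneAgainst_of_ne hj] using ha

theorem oneAgainst_mem_profiles {G : Oligopoly N} {a w : ℝ} (ha : a ∈ G.U) (hw : w ∈ G.U) :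
    oneAgainst N a w ∈ G.profiles := fun j => by
  by_cases hj : j = 0
  · subst hj
    simpa only [oneAgainst_zero] using hw
  · simpa only [oneAgainst_of_ne hj] using ha

/-- The rate of the deviating player at the state `y + ε κ(y)`, where `a = u(t, ·)`. -/
noncomputable def varied (N : ℕ) (κ a : ℝ → ℝ) (ε y : ℝ) : ℝ :=
  N * (a y * (1 + ε * deriv κ y)) - ((N : ℝ) - 1) * a (y + ε * κ y)

theorem varied_of_eq_zero {N : ℕ} {κ a : ℝ → ℝ} {ε y : ℝ} (h : κ y = 0) (h' : deriv κ y = 0) :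
    varied N κ a ε y = a y := by
  simp [varied, h, h']
  ring

theorem varied_zero {N : ℕ} (κ a : ℝ → ℝ) (y : ℝ) : varied N κ a 0 y = a y := by
  simp [varied]
  ring

section Varied

variable {κ : ℝ → ℝ} (hκ : ContDiff ℝ 2 κ) (hκc : HasCompactSupport κ)
  (hκs : tsupport κ ⊆ Ioi 0)

theorem deviation_add_mul {N : ℕ} (hκ : ContDiff ℝ 2 κ) {ε : ℝ} {Λ a : ℝ → ℝ}
    (h : IsStateChange (fun y => y + ε * κ y) Λ) (z : ℝ) :
    deviation N (fun y => y + ε * κ y) Λ a z = varied N κ a ε (Λ z) := by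
  have hd : deriv (fun y => y + ε * κ y) (Λ z) = 1 + ε * deriv κ (Λ z) :=
    ((hasDerivAt_id (Λ z)).add
      ((hκ.differentiable (by norm_num) (Λ z)).hasDerivAt.const_mul ε)).deriv
  have hz : Λ z + ε * κ (Λ z) = z := h.right_inv z
  rw [deviation, varied, hd, hz]

include hκ hκc hκs

theorem eventually_isStateChange :
    ∀ᶠ ε in nhds (0 : ℝ), ∃ Λ, IsStateChange (fun y => y + ε * κ y) Λ := by
  have hκ' : Continuous (deriv κ) := hκ.continuous_deriv (by norm_num)
  obtain ⟨M, hM⟩ := hκc.deriv.exists_bound_of_continuous hκ'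
  have hM0 : 0 ≤ M := (norm_nonneg _).trans (hM 0)
  have hκ0 : κ 0 = 0 := image_eq_zero_of_notMem_tsupport fun h => lt_irrefl (0 : ℝ) (hκs h)
  have h1 : ∀ᶠ ε in nhds (0 : ℝ), |ε| * M < 1 := by
    have : Continuous fun ε : ℝ => |ε| * M := by fun_prop
    exact this.continuousAt.eventually_lt continuousAt_const (by simp)
  filter_upwards [h1] with ε hε
  refine exists_isStateChange_add_mul hκ hκc hκ0 fun y => ?_
  have h2 : |ε * deriv κ y| ≤ |ε| * M := by
    rw [abs_mul]; exact mul_le_mul_of_nonneg_left (hM y) (abs_nonneg _)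
  linarith [(abs_le.1 h2).1]

/-- Small variations respect the control region: outside the support of `κ` nothing changes, and
on the compact support the rates remain in the interior of the control region. -/
theorem eventually_varied_mem {N : ℕ} {T : ℝ} {u ut ux : ℝ → ℝ → ℝ} (h : HasPartials T u ut ux)
    {U : Set ℝ} (hint : ∀ t ∈ Icc 0 T, ∀ x ∈ Ioi (0 : ℝ), u t x ∈ interior U) :
    ∀ᶠ ε in nhds (0 : ℝ), ∀ t ∈ Icc 0 T, ∀ y ∈ Ioi (0 : ℝ), varied N κ (u t) ε y ∈ U := by
  have hκ' : Continuous (deriv κ) := hκ.continuous_deriv (by norm_num)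
  have hK : IsCompact (Icc 0 T ×ˢ tsupport κ) := isCompact_Icc.prod hκc
  have key := hK.eventually_forall_of_forall_eventually (x₀ := (0 : ℝ))
    (P := fun ε q => q.1 ∈ Icc 0 T → varied N κ (u q.1) ε q.2 ∈ U) (by
      rintro ⟨t, y⟩ ⟨ht, hy⟩
      have hy0 : 0 < y := hκs hy
      set S : Set (ℝ × ℝ × ℝ) := {q | q.2.1 ∈ Icc 0 T} with hS
      suffices hev : ∀ᶠ q in nhdsWithin ((0 : ℝ), (t, y)) S,
          varied N κ (u q.2.1) q.1 q.2.2 ∈ U from eventually_nhdsWithin_iff.1 hev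
      have hcu : ContinuousWithinAt (fun q : ℝ × ℝ => u q.1 q.2) (Icc 0 T ×ˢ Ioi 0) (t, y) :=
        h.continuousOn (t, y) ⟨ht, hy0⟩
      have c1 : ContinuousAt (fun q : ℝ × ℝ × ℝ => (q.2.1, q.2.2 + q.1 * κ q.2.2))
          ((0 : ℝ), (t, y)) := by
        have := hκ.continuous
        fun_prop
      have c2 : ContinuousAt (fun q : ℝ × ℝ × ℝ => (q.2.1, q.2.2)) ((0 : ℝ), (t, y)) := by
        fun_prop
      have t1 : Filter.Tendsto (fun q : ℝ × ℝ × ℝ => (q.2.1, q.2.2 + q.1 * κ q.2.2))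
          (nhdsWithin ((0 : ℝ), (t, y)) S) (nhdsWithin (t, y) (Icc 0 T ×ˢ Ioi 0)) := by
        refine tendsto_nhdsWithin_iff.2 ⟨?_, ?_⟩
        · have := c1.tendsto.mono_left (nhdsWithin_le_nhds (s := S))
          simpa using this
        · have hp : ∀ᶠ q in nhdsWithin ((0 : ℝ), (t, y)) S, 0 < q.2.2 + q.1 * κ q.2.2 :=
            nhdsWithin_le_nhds ((continuousAt_snd.comp c1).eventually_const_lt (by simpa using hy0))
          filter_upwards [self_mem_nhdsWithin, hp] with q hq hq'
          exact ⟨hq, hq'⟩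
      have t2 : Filter.Tendsto (fun q : ℝ × ℝ × ℝ => (q.2.1, q.2.2))
          (nhdsWithin ((0 : ℝ), (t, y)) S) (nhdsWithin (t, y) (Icc 0 T ×ˢ Ioi 0)) := by
        refine tendsto_nhdsWithin_iff.2 ⟨c2.tendsto.mono_left nhdsWithin_le_nhds, ?_⟩
        have hp : ∀ᶠ q in nhdsWithin ((0 : ℝ), (t, y)) S, 0 < q.2.2 :=
          nhdsWithin_le_nhds ((continuousAt_snd.comp c2).eventually_const_lt hy0)
        filter_upwards [self_mem_nhdsWithin, hp] with q hq hq'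
        exact ⟨hq, hq'⟩
      have c3 : ContinuousAt (fun q : ℝ × ℝ × ℝ => 1 + q.1 * deriv κ q.2.2) ((0 : ℝ), (t, y)) := by
        fun_prop
      have h3 : Filter.Tendsto (fun q : ℝ × ℝ × ℝ => varied N κ (u q.2.1) q.1 q.2.2)
          (nhdsWithin ((0 : ℝ), (t, y)) S) (nhds (u t y)) := by
        have := (((hcu.tendsto.comp t2).mul (c3.tendsto.mono_left nhdsWithin_le_nhds)).const_mul
          (N : ℝ)).sub ((hcu.tendsto.comp t1).const_mul ((N : ℝ) - 1))
        have e : (N : ℝ) * (u t y * (1 + 0 * deriv κ y)) - ((N : ℝ) - 1) * u t y = u t y := by ring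
        rw [← e]
        exact this
      exact h3 (mem_interior_iff_mem_nhds.1 (hint t ht y hy0)))
  filter_upwards [key] with ε hε t ht y hy
  by_cases hyK : y ∈ tsupport κ
  · exact hε (t, y) ⟨ht, hyK⟩ ht
  · rw [varied_of_eq_zero (image_eq_zero_of_notMem_tsupport hyK)]
    · exact interior_subset (hint t ht y hy)
    · exact Function.notMem_support.1 fun hh => hyK (support_deriv_subset hh)

end Varied

/-- The first-order condition of player `0` in integrated form: if no small variation
`y + ε κ(y)` of the trajectory `y` is profitable, the Euler expression is orthogonal to `κ ∘ y`. -/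
theorem integral_euler_eq_zero {G : Oligopoly N} (hG : G.Standard) {T : ℝ} {u ut ux : ℝ → ℝ → ℝ}
    (h : HasPartials T u ut ux)
    (hint : ∀ t ∈ Icc 0 T, ∀ x ∈ Ioi (0 : ℝ), u t x ∈ interior G.U)
    {a b : ℝ} (ha : 0 ≤ a) (hab : a < b) (hb : b ≤ T) {y : ℝ → ℝ}
    (hy : ∀ s ∈ Icc a b, 0 < y s ∧ HasDerivWithinAt y (-(N : ℝ) * u s (y s)) (Icc a b) s)
    {κ : ℝ → ℝ} (hκ : ContDiff ℝ 2 κ) (hκc : HasCompactSupport κ) (hκs : tsupport κ ⊆ Ioi 0)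
    (hκa : κ (y a) = 0) (hκb : κ (y b) = 0)
    (hmax : ∀ᶠ ε in nhds (0 : ℝ),
      ∫ s in a..b, Real.exp (-G.r * (s - a)) *
          G.L 0 (oneAgainst N (u s (y s + ε * κ (y s))) (varied N κ (u s) ε (y s))) ≤
        ∫ s in a..b, Real.exp (-G.r * (s - a)) * G.L 0 (fun _ => u s (y s))) :
    ∫ s in a..b, Real.exp (-G.r * (s - a)) * (-G.r * G.marginal (u s (y s)) +
      G.marginalSlope (u s (y s)) * (ut s (y s) + G.f (u s (y s)) * ux s (y s))) * κ (y s) = 0 := by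
  obtain ⟨O, hO, hUO, hL⟩ := hG.L_smooth
  obtain ⟨D, hDo, hUD, cm, cs, cx⟩ := hG.exists_isOpen_continuousOn
  have hκ' : Continuous (deriv κ) := hκ.continuous_deriv (by norm_num)
  have hκd : ∀ ξ, HasDerivAt κ (deriv κ ξ) ξ := fun ξ =>
    (hκ.differentiable (by norm_num) ξ).hasDerivAt
  have hIT : Icc a b ⊆ Icc 0 T := Icc_subset_Icc ha hb
  have huU : ∀ t ∈ Icc 0 T, ∀ x ∈ Ioi (0 : ℝ), u t x ∈ G.U := fun t ht x hx =>
    interior_subset (hint t ht x hx)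
  have hyc : ContinuousOn y (Icc a b) := fun s hs => (hy s hs).2.continuousWithinAt
  obtain ⟨δ, hδ, hball⟩ : ∃ δ > 0, ∀ ε ∈ Ioo (-δ) δ,
      (∃ Λ, IsStateChange (fun y => y + ε * κ y) Λ) ∧
      ∀ t ∈ Icc 0 T, ∀ y ∈ Ioi (0 : ℝ), varied N κ (u t) ε y ∈ G.U := by
    obtain ⟨δ, hδ, hb⟩ := Metric.eventually_nhds_iff.1 ((eventually_isStateChange hκ hκc hκs).and
      (eventually_varied_mem (N := N) hκ hκc hκs h hint))
    refine ⟨δ, hδ, fun ε hε => hb ?_⟩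
    rw [Real.dist_eq, sub_zero]
    exact abs_lt.2 hε
  have hz : ∀ ε ∈ Ioo (-δ) δ, ∀ s ∈ Icc a b, 0 < y s + ε * κ (y s) := fun ε hε s hs => by
    obtain ⟨Λ, hΛ⟩ := (hball ε hε).1
    exact (hΛ.pos_iff _).2 (hy s hs).1
  set R : Set (ℝ × ℝ) := Ioo (-δ) δ ×ˢ Icc a b with hR
  have hP : ∀ q ∈ R, oneAgainst N (u q.2 (y q.2 + q.1 * κ (y q.2)))
      (varied N κ (u q.2) q.1 (y q.2)) ∈ O := fun q hq =>
    hUO (oneAgainst_mem_profiles (huU _ (hIT hq.2) _ (hz _ hq.1 _ hq.2))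
      ((hball _ hq.1).2 _ (hIT hq.2) _ (hy _ hq.2).1))
  -- joint continuity in the parameter and the time, on a rectangle of the integrand
  have k1 : ContinuousOn (fun q : ℝ × ℝ => y q.2) R := hyc.comp continuousOn_snd fun q hq => hq.2
  have k2 : ContinuousOn (fun q : ℝ × ℝ => (q.2, y q.2 + q.1 * κ (y q.2))) R :=
    continuousOn_snd.prodMk (k1.add (continuousOn_fst.mul (hκ.continuous.comp_continuousOn k1)))
  have m2 : MapsTo (fun q : ℝ × ℝ => (q.2, y q.2 + q.1 * κ (y q.2))) R (Icc 0 T ×ˢ Ioi 0) :=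
    fun q hq => ⟨hIT hq.2, hz _ hq.1 _ hq.2⟩
  have k3 : ContinuousOn (fun q : ℝ × ℝ => u q.2 (y q.2 + q.1 * κ (y q.2))) R :=
    h.continuousOn.comp k2 m2
  have k4 : ContinuousOn (fun q : ℝ × ℝ => ux q.2 (y q.2 + q.1 * κ (y q.2))) R :=
    h.continuousOn_state.comp k2 m2
  have k5 : ContinuousOn (fun q : ℝ × ℝ => u q.2 (y q.2)) R :=
    h.continuousOn.comp (continuousOn_snd.prodMk k1) fun q hq => ⟨hIT hq.2, (hy _ hq.2).1⟩
  have k6 : ContinuousOn (fun q : ℝ × ℝ => deriv κ (y q.2)) R := hκ'.comp_continuousOn k1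
  have k7 : ContinuousOn (fun q : ℝ × ℝ => κ (y q.2)) R := hκ.continuous.comp_continuousOn k1
  have k8 : ContinuousOn (fun q : ℝ × ℝ => varied N κ (u q.2) q.1 (y q.2)) R :=
    (continuousOn_const.mul (k5.mul (continuousOn_const.add (continuousOn_fst.mul k6)))).sub
      (continuousOn_const.mul k3)
  have k9 := continuousOn_oneAgainst (N := N) k3 k8
  have k10 : ContinuousOn (fun q : ℝ × ℝ => Real.exp (-G.r * (q.2 - a))) R := by fun_prop
  set dP : ℝ → ℝ → Fin N → ℝ := fun ε s => oneAgainst N (ux s (y s + ε * κ (y s)) * κ (y s))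
    (N * (u s (y s) * deriv κ (y s)) - ((N : ℝ) - 1) * (ux s (y s + ε * κ (y s)) * κ (y s)))
    with hdP
  have k11 : ContinuousOn (fun q : ℝ × ℝ => dP q.1 q.2) R :=
    continuousOn_oneAgainst (k4.mul k7) ((continuousOn_const.mul (k5.mul k6)).sub
      (continuousOn_const.mul (k4.mul k7)))
  set ψ' : ℝ → ℝ → ℝ := fun ε s => Real.exp (-G.r * (s - a)) *
    fderiv ℝ (G.L 0) (oneAgainst N (u s (y s + ε * κ (y s))) (varied N κ (u s) ε (y s))) (dP ε s)
    with hψ'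
  have k12 : ContinuousOn (fun q : ℝ × ℝ => ψ' q.1 q.2) R :=
    k10.mul ((((hL 0).continuousOn_fderiv_of_isOpen hO (by norm_num)).comp k9 hP).clm_apply k11)
  have hLd : ∀ v ∈ O, DifferentiableAt ℝ (G.L 0) v := fun v hv =>
    ((hL 0).differentiableOn (by norm_num)).differentiableAt (hO.mem_nhds hv)
  have hJ := hasDerivAt_integral_of_continuousOn_deriv hab.le hδ
    (ψ := fun ε s => Real.exp (-G.r * (s - a)) *
      G.L 0 (oneAgainst N (u s (y s + ε * κ (y s))) (varied N κ (u s) ε (y s)))) (ψ' := ψ')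
    (fun ε hε => (k10.mul ((hL 0).continuousOn.comp k9 hP)).comp (f := fun s => (ε, s))
      (by fun_prop) fun s hs => ⟨hε, hs⟩)
    (fun ε hε s hs => by
      have d1 : HasDerivAt (fun ε => y s + ε * κ (y s)) (κ (y s)) ε := by
        simpa using ((hasDerivAt_id ε).mul_const (κ (y s))).const_add (y s)
      have d2 : HasDerivAt (fun ε => u s (y s + ε * κ (y s)))
          (ux s (y s + ε * κ (y s)) * κ (y s)) ε :=
        (h.hasDerivAt_state (hIT hs) (hz ε hε s hs)).comp ε d1
      have d3 : HasDerivAt (fun ε => varied N κ (u s) ε (y s)) (N * (u s (y s) * deriv κ (y s)) -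
          ((N : ℝ) - 1) * (ux s (y s + ε * κ (y s)) * κ (y s))) ε := by
        have := ((((hasDerivAt_id ε).mul_const (deriv κ (y s))).const_add 1).const_mul
          (u s (y s))).const_mul (N : ℝ)
        exact (this.sub (d2.const_mul ((N : ℝ) - 1))).congr_deriv (by rw [one_mul])
      exact ((hLd _ (hP (ε, s) ⟨hε, hs⟩)).hasFDerivAt.comp_hasDerivAt ε
        (hasDerivAt_oneAgainst d2 d3)).const_mul _) k12
  have hψ0 : ∫ s in a..b, ψ' 0 s = 0 := by
    refine IsLocalMax.hasDerivAt_eq_zero ?_ hJ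
    filter_upwards [hmax] with ε hε
    simpa only [zero_mul, add_zero, varied_zero, oneAgainst_self] using hε
  -- integration by parts
  have h0 : (0 : ℝ) ∈ Ioo (-δ) δ := ⟨by linarith, hδ⟩
  have huy : ∀ s ∈ Icc a b, u s (y s) ∈ G.U := fun s hs => huU s (hIT hs) _ (hy s hs).1
  have hS0 := fun s hs => hG.marginalSlope_ne_zero (huy s hs)
  set dM : ℝ → ℝ := fun s =>
    (Real.exp (-G.r * (s - a)) * -G.r * G.marginal (u s (y s)) + Real.exp (-G.r * (s - a)) *
      (G.marginalSlope (u s (y s)) * (ut s (y s) + ux s (y s) * (-(N : ℝ) * u s (y s))))) *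
      κ (y s) + Real.exp (-G.r * (s - a)) * G.marginal (u s (y s)) *
      (deriv κ (y s) * (-(N : ℝ) * u s (y s))) with hdM
  have hMd : ∀ s ∈ Icc a b, HasDerivWithinAt (fun s => Real.exp (-G.r * (s - a)) *
      G.marginal (u s (y s)) * κ (y s)) (dM s) (Icc a b) s := fun s hs => by
    have d1 : HasDerivWithinAt (fun s => Real.exp (-G.r * (s - a)))
        (Real.exp (-G.r * (s - a)) * -G.r) (Icc a b) s := by
      have := (((hasDerivAt_id s).sub_const a).const_mul (-G.r)).exp
      simpa using this.hasDerivWithinAt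
    have d2 := h.hasDerivWithinAt_comp hs (fun τ hτ => ⟨hIT hτ, (hy τ hτ).1⟩) (hy s hs).2
    have d3 := (hG.hasDerivAt_marginal (huy s hs)).comp_hasDerivWithinAt s d2
    have d4 := (hκd (y s)).comp_hasDerivWithinAt s (hy s hs).2
    exact (d1.mul d3).mul d4
  have c0 : ContinuousOn (fun s => (s, y s)) (Icc a b) := continuousOn_id.prodMk hyc
  have m0 : MapsTo (fun s => (s, y s)) (Icc a b) (Icc 0 T ×ˢ Ioi 0) := fun s hs =>
    ⟨hIT hs, (hy s hs).1⟩
  have c1 : ContinuousOn (fun s => u s (y s)) (Icc a b) := h.continuousOn.comp c0 m0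
  have c2 : ContinuousOn (fun s => ut s (y s)) (Icc a b) := h.continuousOn_time.comp c0 m0
  have c3 : ContinuousOn (fun s => ux s (y s)) (Icc a b) := h.continuousOn_state.comp c0 m0
  have c4 := cm.comp c1 fun s hs => hUD (huy s hs)
  have c5 := cs.comp c1 fun s hs => hUD (huy s hs)
  have c6 : ContinuousOn (fun s => Real.exp (-G.r * (s - a))) (Icc a b) := by fun_prop
  have cdM : ContinuousOn dM (Icc a b) :=
    ((((c6.mul continuousOn_const).mul c4).add (c6.mul (c5.mul (c2.add (c3.mul
      (continuousOn_const.mul c1)))))).mul (hκ.continuous.comp_continuousOn hyc)).add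
      ((c6.mul c4).mul ((hκ'.comp_continuousOn hyc).mul (continuousOn_const.mul c1)))
  have hIcc : uIcc a b = Icc a b := uIcc_of_le hab.le
  have hM0 : ∫ s in a..b, dM s = 0 := by
    rw [intervalIntegral.integral_eq_sub_of_hasDerivAt_of_le hab.le
      (fun s hs => (hMd s hs).continuousWithinAt)
      (fun s hs => (hMd s (Ioo_subset_Icc_self hs)).hasDerivAt (Icc_mem_nhds hs.1 hs.2))
      (hIcc ▸ cdM).intervalIntegrable, hκa, hκb]
    simp
  have cψ : ContinuousOn (ψ' 0) (Icc a b) :=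
    k12.comp (f := fun s => ((0 : ℝ), s)) (by fun_prop) fun s hs => ⟨h0, hs⟩
  rw [show (0 : ℝ) = (∫ s in a..b, ψ' 0 s) + ∫ s in a..b, dM s by rw [hψ0, hM0, add_zero],
    ← intervalIntegral.integral_add (hIcc ▸ cψ).intervalIntegrable
      (hIcc ▸ cdM).intervalIntegrable]
  refine intervalIntegral.integral_congr fun s hs => ?_
  rw [hIcc] at hs
  have hfS : G.marginalSlope (u s (y s)) * G.f (u s (y s)) =
      -(N : ℝ) * u s (y s) * G.marginalSlope (u s (y s)) -
        ((N : ℝ) - 1) * G.marginal (u s (y s)) + G.external (u s (y s)) := by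
    have := hS0 s hs
    rw [f_eq, e_eq]
    field_simp
    ring
  have hPs := hP (0, s) ⟨h0, hs⟩
  have hfd := fderiv_apply_eq_sum_partialD (hLd _ hPs) (dP 0 s)
  simp only [hdP, sum_oneAgainst_mul] at hfd
  simp only [zero_mul, add_zero, varied_zero, oneAgainst_self] at hfd
  have hψs : ψ' 0 s = Real.exp (-G.r * (s - a)) *
      ((N * (u s (y s) * deriv κ (y s)) - ((N : ℝ) - 1) * (ux s (y s) * κ (y s))) *
        G.marginal (u s (y s)) + ux s (y s) * κ (y s) * G.external (u s (y s))) := by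
    simp only [hψ', hdP, zero_mul, add_zero, varied_zero, oneAgainst_self]
    rw [hfd]
    rfl
  simp only [hψs, hdM]
  linear_combination Real.exp (-G.r * (s - a)) * ux s (y s) * κ (y s) * hfS

end Oligopoly

/-! ### The equilibrium equation -/

/-- The fundamental lemma of the calculus of variations for test functions of the state along a
strictly decreasing trajectory. -/
theorem eq_zero_of_integral_mul_comp_eq_zero {P y : ℝ → ℝ} {a b : ℝ} (hab : a < b)
    (hP : ContinuousOn P (Icc a b)) (hyc : ContinuousOn y (Icc a b))
    (hy : StrictAntiOn y (Icc a b))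
    (h : ∀ κ : ℝ → ℝ, ContDiff ℝ 2 κ → HasCompactSupport κ → tsupport κ ⊆ Ioo (y b) (y a) →
      ∫ s in a..b, P s * κ (y s) = 0) : P a = 0 := by
  by_contra hne
  have haI : a ∈ Icc a b := left_mem_Icc.2 hab.le
  obtain ⟨c, hc, hpos⟩ : ∃ c ∈ Ioc a b, ∀ s ∈ Icc a c, 0 < P a * P s := by
    have h1 : ∀ᶠ s in nhdsWithin a (Icc a b), 0 < P a * P s :=
      (continuousWithinAt_const.mul (hP a haI)).eventually_const_lt (mul_self_pos.2 hne)
    rw [nhdsWithin_Icc_eq_nhdsGE hab] at h1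
    obtain ⟨c, hc, hsub⟩ := mem_nhdsGE_iff_exists_Icc_subset.1 h1
    exact ⟨min c b, ⟨lt_min hc hab, min_le_right _ _⟩, fun s hs =>
      hsub ⟨hs.1, hs.2.trans (min_le_left _ _)⟩⟩
  have hcI : c ∈ Icc a b := Ioc_subset_Icc_self hc
  have hyca : y c < y a := hy haI hcI hc.1
  have hybc : y b ≤ y c := hy.antitoneOn hcI (right_mem_Icc.2 hab.le) hc.2
  set m : ℝ := (y c + y a) / 2 with hm
  let κ : ContDiffBump m :=
    ⟨(y a - y c) / 8, (y a - y c) / 4, by linarith, by linarith⟩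
  have hsupp : tsupport κ ⊆ Ioo (y c) (y a) := by
    rw [κ.tsupport_eq, Real.closedBall_eq_Icc]
    change Icc (m - (y a - y c) / 4) (m + (y a - y c) / 4) ⊆ _
    exact fun ξ hξ => ⟨by linarith [hξ.1], by linarith [hξ.2]⟩
  have h0 := h κ κ.contDiff κ.hasCompactSupport (hsupp.trans (Ioo_subset_Ioo_left hybc))
  obtain ⟨s, hs, hsm⟩ : m ∈ y '' Icc a c :=
    intermediate_value_Icc' hc.1.le (hyc.mono (Icc_subset_Icc_right hc.2))
      ⟨by linarith, by linarith⟩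
  have hcont : ContinuousOn (fun s => P a * (P s * κ (y s))) (Icc a b) :=
    continuousOn_const.mul (hP.mul (κ.continuous.comp_continuousOn hyc))
  have hint : 0 < ∫ s in a..b, P a * (P s * κ (y s)) := by
    refine intervalIntegral.integral_pos hab hcont (fun τ hτ => ?_)
      ⟨s, ⟨hs.1, hs.2.trans hc.2⟩, ?_⟩
    · rcases le_or_gt τ c with hτc | hτc
      · rw [← mul_assoc]
        exact mul_nonneg (hpos τ ⟨hτ.1.le, hτc⟩).le κ.nonneg
      · have : κ (y τ) = 0 := image_eq_zero_of_notMem_tsupport fun hh =>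
          absurd (hsupp hh).1 (hy hcI (Ioc_subset_Icc_self hτ) hτc).not_gt
        rw [this, mul_zero, mul_zero]
    · rw [hsm, κ.one_of_mem_closedBall (Metric.mem_closedBall_self κ.rIn_pos.le), mul_one]
      exact hpos s hs
  rw [intervalIntegral.integral_const_mul, h0, mul_zero] at hint
  exact lt_irrefl 0 hint

namespace Oligopoly

variable {N : ℕ} [NeZero N] {G : Oligopoly N}

theorem Standard.pos_of_mem_interior {N : ℕ} {G : Oligopoly N} (hG : G.Standard) {u : ℝ}
    (hu : u ∈ interior G.U) : 0 < u := by
  have : interior G.U ⊆ interior (Ici 0) := interior_mono hG.U_nonneg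
  rw [interior_Ici] at this
  exact this hu

/-- The stock decreases strictly under an interior rule. -/
theorem Standard.strictAntiOn_trajectory (hG : G.Standard) {S : Set ℝ} (hS : Convex ℝ S)
    {v y : ℝ → ℝ} (hv : ∀ s ∈ S, v s ∈ interior G.U)
    (hy : ∀ s ∈ S, HasDerivWithinAt y (-(N : ℝ) * v s) S s) : StrictAntiOn y S := by
  refine strictAntiOn_of_hasDerivWithinAt_neg hS (fun s hs => (hy s hs).continuousWithinAt)
    (fun s hs => (hy s (interior_subset hs)).mono interior_subset) fun s hs => ?_
  have h1 := hG.pos_of_mem_interior (hv s (interior_subset hs))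
  have h2 : (0 : ℝ) < N := by exact_mod_cast NeZero.pos N
  have := mul_pos h2 h1
  linarith

/-- The quasilinear equation `u_t + f(u) u_x = -r e₁(u)` at the starting point of a trajectory,
from the Euler equation there: division by `marginalSlope` produces `f` and `e₁`. -/
theorem equation_of_integral_euler (hG : G.Standard) {T : ℝ} {u ut ux : ℝ → ℝ → ℝ}
    (h : HasPartials T u ut ux)
    (hint : ∀ t ∈ Icc 0 T, ∀ x ∈ Ioi (0 : ℝ), u t x ∈ interior G.U)
    {a b : ℝ} (ha : 0 ≤ a) (hab : a < b) (hb : b ≤ T) {y : ℝ → ℝ}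
    (hy : ∀ s ∈ Icc a b, 0 < y s ∧ HasDerivWithinAt y (-(N : ℝ) * u s (y s)) (Icc a b) s)
    (hmax : ∀ κ : ℝ → ℝ, ContDiff ℝ 2 κ → HasCompactSupport κ → tsupport κ ⊆ Ioo (y b) (y a) →
      ∀ᶠ ε in nhds (0 : ℝ),
        ∫ s in a..b, Real.exp (-G.r * (s - a)) *
            G.L 0 (oneAgainst N (u s (y s + ε * κ (y s))) (varied N κ (u s) ε (y s))) ≤
          ∫ s in a..b, Real.exp (-G.r * (s - a)) * G.L 0 (fun _ => u s (y s))) :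
    ut a (y a) + G.f (u a (y a)) * ux a (y a) = -G.r * G.e (u a (y a)) := by
  have hIT : Icc a b ⊆ Icc 0 T := Icc_subset_Icc ha hb
  have hyc : ContinuousOn y (Icc a b) := fun s hs => (hy s hs).2.continuousWithinAt
  have huU : ∀ s ∈ Icc a b, u s (y s) ∈ G.U := fun s hs =>
    interior_subset (hint s (hIT hs) _ (hy s hs).1)
  have haI : a ∈ Icc a b := left_mem_Icc.2 hab.le
  obtain ⟨D, hDo, hUD, cm, cs, cx⟩ := hG.exists_isOpen_continuousOn
  obtain ⟨V, hV⟩ := hG.exists_regularInterval ⟨_, huU a haI⟩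
  have c0 : ContinuousOn (fun s => (s, y s)) (Icc a b) := continuousOn_id.prodMk hyc
  have m0 : MapsTo (fun s => (s, y s)) (Icc a b) (Icc 0 T ×ˢ Ioi 0) := fun s hs =>
    ⟨hIT hs, (hy s hs).1⟩
  have c1 : ContinuousOn (fun s => u s (y s)) (Icc a b) := h.continuousOn.comp c0 m0
  have hPc : ContinuousOn (fun s => Real.exp (-G.r * (s - a)) * (-G.r * G.marginal (u s (y s)) +
      G.marginalSlope (u s (y s)) * (ut s (y s) + G.f (u s (y s)) * ux s (y s)))) (Icc a b) := by
    refine ContinuousOn.mul (by fun_prop) ((continuousOn_const.mul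
      (cm.comp c1 fun s hs => hUD (huU s hs))).add ((cs.comp c1 fun s hs => hUD (huU s hs)).mul
      ((h.continuousOn_time.comp c0 m0).add ((hV.continuousOn_f.comp c1 fun s hs =>
        hV.subset (huU s hs)).mul (h.continuousOn_state.comp c0 m0)))))
  have hanti : StrictAntiOn y (Icc a b) := hG.strictAntiOn_trajectory (convex_Icc a b)
    (fun s hs => hint s (hIT hs) _ (hy s hs).1) fun s hs => (hy s hs).2
  have hP := eq_zero_of_integral_mul_comp_eq_zero hab hPc hyc hanti fun κ h1 h2 h3 =>
    integral_euler_eq_zero hG h hint ha hab hb hy h1 h2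
      (h3.trans fun ξ hξ => (hy b (right_mem_Icc.2 hab.le)).1.trans hξ.1)
      (image_eq_zero_of_notMem_tsupport fun hh => lt_irrefl _ (h3 hh).2)
      (image_eq_zero_of_notMem_tsupport fun hh => lt_irrefl _ (h3 hh).1) (hmax κ h1 h2 h3)
  have hS := hG.marginalSlope_ne_zero (huU a haI)
  simp only [sub_self, mul_zero, Real.exp_zero, one_mul] at hP
  rw [e_eq]
  field_simp
  linear_combination hP

/-- On a finite horizon, an interior symmetric equilibrium solves `u_t + f(u) u_x = -r e₁(u)`. -/
theorem IsMPNE.equation (hG : G.Standard) {T : ℝ} {u ut ux : ℝ → ℝ → ℝ}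
    (h : HasPartials T u ut ux)
    (hint : ∀ t ∈ Icc 0 T, ∀ x ∈ Ioi (0 : ℝ), u t x ∈ interior G.U)
    (hM : G.IsMPNE T (fun t x _ => u t x)) {t x : ℝ} (ht : t ∈ Ico 0 T) (hx : x ∈ Ioi (0 : ℝ)) :
    ut t x + G.f (u t x) * ux t x = -G.r * G.e (u t x) := by
  have ht' : t ∈ Icc 0 T := Ico_subset_Icc_self ht
  obtain ⟨y, hy⟩ := (hM.1.2 t ht' x hx).1
  have hyt : y t = x := hy.1
  have hyd : ∀ s ∈ Icc t T, 0 < y s ∧ HasDerivWithinAt y (-(N : ℝ) * u s (y s)) (Icc t T) s :=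
    fun s hs => by simpa only [dyn_const] using hy.2 s hs
  rw [← hyt]
  refine equation_of_integral_euler hG h hint ht.1 ht.2 le_rfl hyd fun κ hκ hκc hκs => ?_
  have hκ0 : tsupport κ ⊆ Ioi 0 :=
    hκs.trans fun ξ hξ => (hyd T (right_mem_Icc.2 ht.2.le)).1.trans hξ.1
  have hκt : κ (y t) = 0 := image_eq_zero_of_notMem_tsupport fun hh => lt_irrefl _ (hκs hh).2
  have hκT : κ (y T) = 0 := image_eq_zero_of_notMem_tsupport fun hh => lt_irrefl _ (hκs hh).1
  filter_upwards [eventually_isStateChange hκ hκc hκ0,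
    eventually_varied_mem (N := N) hκ hκc hκ0 h hint] with ε ⟨Λ, hΛ⟩ hε
  have hl : ∀ ξ, Λ (ξ + ε * κ ξ) = ξ := hΛ.left_inv
  have hΛx : Λ x = x := by
    have := hl x
    rwa [← hyt, hκt, mul_zero, add_zero, hyt] at this
  have hadm : Admissible dyn T G.profiles (fun t x =>
      oneAgainst N (u t x) (deviation N (fun y => y + ε * κ y) Λ (u t) x)) :=
    admissible_deviation hΛ hM.1 fun s hs ξ hξ => by
      rw [deviation_add_mul hκ hΛ]
      exact hε s hs _ ((hΛ.inv_pos_iff ξ).2 hξ)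
  have hz : IsTrajectory dyn (fun s ξ =>
      oneAgainst N (u s ξ) (deviation N (fun y => y + ε * κ y) Λ (u s) ξ)) T t x
      (fun s => y s + ε * κ (y s)) := by
    rw [isTrajectory_deviation_iff hΛ, hΛx]
    simpa only [hl] using hy
  have key := hM.2 0 (fun t x => deviation N (fun y => y + ε * κ y) Λ (u t) x) hadm t ht' x hx
    _ y hz hy
  change payoff (G.L 0) G.r G.B (fun s ξ =>
    oneAgainst N (u s ξ) (deviation N (fun y => y + ε * κ y) Λ (u s) ξ)) T t
    (fun s => y s + ε * κ (y s)) ≤ _ at key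
  simpa only [payoff, deviation_add_mul hκ hΛ, hl, hκT, mul_zero, add_zero, add_le_add_iff_right]
    using key

/-- On the infinite horizon, an interior symmetric equilibrium solves `f(u) u' = -r e₁(u)`. -/
theorem IsStatMPNE.equation (hG : G.Standard) {u : ℝ → ℝ}
    (hint : ∀ x ∈ Ioi (0 : ℝ), u x ∈ interior G.U)
    (hM : G.IsStatMPNE (fun x _ => u x)) {x : ℝ} (hx : x ∈ Ioi (0 : ℝ)) :
    G.f (u x) * deriv u x = -G.r * G.e (u x) := by
  have huc : ContDiffOn ℝ 1 u (Ioi 0) := contDiffOn_pi.1 hM.1.1.1 0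
  have h : HasPartials 1 (fun _ => u) (fun _ _ => 0) (fun _ => deriv u) :=
    hasPartials_of_stationary huc
  have hint' : ∀ t ∈ Icc (0 : ℝ) 1, ∀ x ∈ Ioi (0 : ℝ), (fun _ => u) t x ∈ interior G.U :=
    fun _ _ => hint
  obtain ⟨y, hy⟩ := (hM.1.2 x hx).1
  have hy0 : y 0 = x := hy.1
  have hyd : ∀ s ∈ Ici (0 : ℝ), 0 < y s ∧ HasDerivWithinAt y (-(N : ℝ) * u (y s)) (Ici 0) s :=
    fun s hs => by simpa only [dyn_const] using hy.2 s hs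
  have hanti : StrictAntiOn y (Ici 0) := hG.strictAntiOn_trajectory (convex_Ici 0)
    (fun s hs => hint _ (hyd s hs).1) fun s hs => (hyd s hs).2
  have hyc : ContinuousOn y (Ici 0) := fun s hs => (hyd s hs).2.continuousWithinAt
  suffices hsuff : (0 : ℝ) + G.f (u (y 0)) * deriv u (y 0) = -G.r * G.e (u (y 0)) by
    rwa [hy0, zero_add] at hsuff
  refine equation_of_integral_euler hG h hint' le_rfl zero_lt_one le_rfl
    (fun s hs => ⟨(hyd s hs.1).1, (hyd s hs.1).2.mono Icc_subset_Ici_self⟩)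
    fun κ hκ hκc hκs => ?_
  have hκ0 : tsupport κ ⊆ Ioi 0 := hκs.trans fun ξ hξ => (hyd 1 (mem_Ici.2 zero_le_one)).1.trans hξ.1
  have hκx : κ (y 0) = 0 := image_eq_zero_of_notMem_tsupport fun hh => lt_irrefl _ (hκs hh).2
  have hlate : ∀ s ∈ Ici (1 : ℝ), y s ∉ tsupport κ := fun s hs hh =>
    (hκs hh).1.not_ge (hanti.antitoneOn (zero_le_one : (0 : ℝ) ≤ 1)
      (zero_le_one.trans hs : (0 : ℝ) ≤ s) hs)
  filter_upwards [eventually_isStateChange hκ hκc hκ0,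
    eventually_varied_mem (N := N) hκ hκc hκ0 h hint'] with ε ⟨Λ, hΛ⟩ hε
  have hε' : ∀ ξ ∈ Ioi (0 : ℝ), varied N κ u ε ξ ∈ G.U := hε 0 ⟨le_rfl, zero_le_one⟩
  have hl : ∀ ξ, Λ (ξ + ε * κ ξ) = ξ := hΛ.left_inv
  have hΛx : Λ x = x := by
    have := hl x
    rwa [← hy0, hκx, mul_zero, add_zero, hy0] at this
  have hadm : StatAdmissible dyn G.profiles (fun x =>
      oneAgainst N (u x) (deviation N (fun y => y + ε * κ y) Λ u x)) :=
    statAdmissible_deviation hΛ hM.1 fun ξ hξ => by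
      rw [deviation_add_mul hκ hΛ]
      exact hε' _ ((hΛ.inv_pos_iff ξ).2 hξ)
  have hz : IsStatTrajectory dyn (fun ξ =>
      oneAgainst N (u ξ) (deviation N (fun y => y + ε * κ y) Λ u ξ)) x
      (fun s => y s + ε * κ (y s)) := by
    rw [isStatTrajectory_deviation_iff hΛ, hΛx]
    simpa only [hl] using hy
  obtain ⟨hconv, hopt⟩ := hM.2 0 x hx y hy
  set I₁ : ℝ → ℝ := fun s => Real.exp (-G.r * s) *
    G.L 0 (oneAgainst N (u (y s + ε * κ (y s))) (varied N κ u ε (y s))) with hI₁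
  set I₀ : ℝ → ℝ := fun s => Real.exp (-G.r * s) * G.L 0 (fun _ => u (y s)) with hI₀
  have hI₁eq : statIntegrand (G.L 0) G.r (fun ξ =>
      oneAgainst N (u ξ) (deviation N (fun y => y + ε * κ y) Λ u ξ))
      (fun s => y s + ε * κ (y s)) = I₁ := by
    funext s
    simp only [statIntegrand, deviation_add_mul hκ hΛ, hl, hI₁]
  -- the variation does not affect the payoff flow after time `1`
  have hagree : EqOn I₁ I₀ (Ioi 1) := fun s hs => by
    have hs' := hlate s (mem_Ici.2 (le_of_lt hs))
    have h1 : κ (y s) = 0 := image_eq_zero_of_notMem_tsupport hs'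
    have h2 : deriv κ (y s) = 0 := Function.notMem_support.1 fun hh =>
      hs' (support_deriv_subset hh)
    simp only [hI₁, hI₀, varied_of_eq_zero h1 h2, h1, mul_zero, add_zero, oneAgainst_self]
  have hsplit : Ioi (0 : ℝ) = Ioc 0 1 ∪ Ioi 1 := (Ioc_union_Ioi_eq_Ioi zero_le_one).symm
  have hI₀i : IntegrableOn I₀ (Ioi 0) := hconv
  have hI₁late : IntegrableOn I₁ (Ioi 1) :=
    (hI₀i.mono_set (Ioi_subset_Ioi zero_le_one)).congr_fun hagree.symm measurableSet_Ioi
  have hI₁c : ContinuousOn I₁ (Icc 0 1) := by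
    obtain ⟨O, hO, hUO, hL⟩ := hG.L_smooth
    have hyc' : ContinuousOn y (Icc 0 1) := hyc.mono Icc_subset_Ici_self
    have hzpos : ∀ s ∈ Icc (0 : ℝ) 1, y s + ε * κ (y s) ∈ Ioi 0 := fun s hs =>
      (hΛ.pos_iff _).2 (hyd s hs.1).1
    have k1 : ContinuousOn (fun s => u (y s + ε * κ (y s))) (Icc 0 1) :=
      huc.continuousOn.comp
        (hyc'.add (continuousOn_const.mul (hκ.continuous.comp_continuousOn hyc'))) hzpos
    have k2 : ContinuousOn (fun s => varied N κ u ε (y s)) (Icc 0 1) :=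
      (continuousOn_const.mul ((huc.continuousOn.comp hyc' fun s hs => (hyd s hs.1).1).mul
        (continuousOn_const.add (continuousOn_const.mul
          ((hκ.continuous_deriv (by norm_num)).comp_continuousOn hyc'))))).sub
        (continuousOn_const.mul k1)
    refine ContinuousOn.mul (by fun_prop) ((hL 0).continuousOn.comp
      (continuousOn_oneAgainst k1 k2) fun s hs => hUO (oneAgainst_mem_profiles
        (interior_subset (hint _ (hzpos s hs))) (hε' _ (hyd s hs.1).1)))
  have hI₁early : IntegrableOn I₁ (Ioc 0 1) :=
    (hI₁c.integrableOn_compact isCompact_Icc).mono_set Ioc_subset_Icc_self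
  have hI₁i : IntegrableOn I₁ (Ioi 0) := hsplit ▸ hI₁early.union hI₁late
  have key : ∫ s in Ioi 0, I₁ s ≤ ∫ s in Ioi 0, I₀ s := by
    have := hopt (fun x => deviation N (fun y => y + ε * κ y) Λ u x) hadm _ hz
      (by
        change IntegrableOn (statIntegrand (G.L 0) G.r (fun ξ =>
          oneAgainst N (u ξ) (deviation N (fun y => y + ε * κ y) Λ u ξ))
          (fun s => y s + ε * κ (y s))) (Ioi 0)
        rwa [hI₁eq])
    change ∫ s in Ioi 0, statIntegrand (G.L 0) G.r (fun ξ =>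
          oneAgainst N (u ξ) (deviation N (fun y => y + ε * κ y) Λ u ξ))
          (fun s => y s + ε * κ (y s)) s ≤ _ at this
    rwa [hI₁eq] at this
  rw [hsplit, setIntegral_union Ioc_disjoint_Ioi_same measurableSet_Ioi hI₁early hI₁late,
    setIntegral_union Ioc_disjoint_Ioi_same measurableSet_Ioi
      (hI₀i.mono_set Ioc_subset_Ioi_self) (hI₀i.mono_set (Ioi_subset_Ioi zero_le_one)),
    setIntegral_congr_fun measurableSet_Ioi hagree, add_le_add_iff_right] at key
  simpa only [sub_zero, intervalIntegral.integral_of_le (zero_le_one : (0 : ℝ) ≤ 1)] using key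

end Oligopoly

/-! ### Verification on a finite horizon -/

/-- If `∂F/∂s = ∂H/∂θ`, the boundary integrals of `F` and `H` over a rectangle agree. -/
theorem integral_sub_eq_of_mixed_partials {F H Q : ℝ → ℝ → ℝ} {a b : ℝ} (hab : a ≤ b)
    (hQ : ContinuousOn (fun q : ℝ × ℝ => Q q.1 q.2) (Icc a b ×ˢ Icc 0 1))
    (hF : ∀ θ ∈ Icc (0 : ℝ) 1, ∀ s ∈ Icc a b,
      HasDerivWithinAt (fun s => F s θ) (Q s θ) (Icc a b) s)
    (hH : ∀ s ∈ Icc a b, ∀ θ ∈ Icc (0 : ℝ) 1,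
      HasDerivWithinAt (fun θ => H s θ) (Q s θ) (Icc 0 1) θ) :
    ∫ s in a..b, (H s 1 - H s 0) = ∫ θ in (0 : ℝ)..1, (F b θ - F a θ) := by
  have hIab : uIcc a b = Icc a b := uIcc_of_le hab
  have hI01 : uIcc (0 : ℝ) 1 = Icc 0 1 := uIcc_of_le zero_le_one
  have h1 : ∀ s ∈ uIcc a b, H s 1 - H s 0 = ∫ θ in (0 : ℝ)..1, Q s θ := fun s hs => by
    rw [hIab] at hs
    refine (intervalIntegral.integral_eq_sub_of_hasDerivAt_of_le zero_le_one
      (fun θ hθ => (hH s hs θ hθ).continuousWithinAt)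
      (fun θ hθ => (hH s hs θ (Ioo_subset_Icc_self hθ)).hasDerivAt (Icc_mem_nhds hθ.1 hθ.2))
      ?_).symm
    have : ContinuousOn (Q s) (Icc 0 1) :=
      hQ.comp (f := fun θ => (s, θ)) (by fun_prop) fun θ hθ => ⟨hs, hθ⟩
    exact (hI01 ▸ this).intervalIntegrable
  have h2 : ∀ θ ∈ uIcc (0 : ℝ) 1, F b θ - F a θ = ∫ s in a..b, Q s θ := fun θ hθ => by
    rw [hI01] at hθ
    refine (intervalIntegral.integral_eq_sub_of_hasDerivAt_of_le hab
      (fun s hs => (hF θ hθ s hs).continuousWithinAt)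
      (fun s hs => (hF θ hθ s (Ioo_subset_Icc_self hs)).hasDerivAt (Icc_mem_nhds hs.1 hs.2))
      ?_).symm
    have : ContinuousOn (fun s => Q s θ) (Icc a b) :=
      hQ.comp (f := fun s => (s, θ)) (by fun_prop) fun s hs => ⟨hs, hθ⟩
    exact (hIab ▸ this).intervalIntegrable
  rw [intervalIntegral.integral_congr h1, intervalIntegral.integral_congr h2]
  refine intervalIntegral_intervalIntegral_swap ?_
  refine (hQ.integrableOn_compact (isCompact_Icc.prod isCompact_Icc)).mono_set ?_
  rw [uIoc_of_le hab, uIoc_of_le zero_le_one]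
  exact prod_mono Ioc_subset_Icc_self Ioc_subset_Icc_self

namespace Oligopoly

variable {N : ℕ} [NeZero N] {G : Oligopoly N}

/-- The candidate costate `-C X(u(t, x))` is the state derivative of a solution of the
Hamilton–Jacobi–Bellman equation. In integrated form, along two trajectories `z` and `w` with a
common starting point: the weighted increase of `X(u) ẋ + (ρ/r) ∫ (f/e₁) X` from `z` to `w` equals
the integral of `X(u(T, ·))` between the terminal states. -/
theorem integral_costate_eq (hG : G.Standard) {T : ℝ} {u ut ux : ℝ → ℝ → ℝ}
    (h : HasPartials T u ut ux) (huU : ∀ t ∈ Icc 0 T, ∀ x ∈ Ioi (0 : ℝ), u t x ∈ G.U)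
    (hpde : ∀ t ∈ Icc 0 T, ∀ x ∈ Ioi (0 : ℝ),
      ut t x + G.f (u t x) * ux t x = -G.r * G.e (u t x))
    {V : Set ℝ} (hV : G.RegularInterval V) {u₀ : ℝ} (hu₀ : u₀ ∈ V) (ρ : ℝ)
    {t : ℝ} (ht : t ∈ Icc 0 T) {z w z' w' : ℝ → ℝ} (hstart : w t = z t)
    (hz : ∀ s ∈ Icc t T, 0 < z s ∧ HasDerivWithinAt z (z' s) (Icc t T) s)
    (hw : ∀ s ∈ Icc t T, 0 < w s ∧ HasDerivWithinAt w (w' s) (Icc t T) s)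
    (hz' : ContinuousOn z' (Icc t T)) (hw' : ContinuousOn w' (Icc t T)) :
    ∫ s in t..T, (Real.exp (-ρ * (s - t)) * (G.expFactor ρ u₀ (u s (w s)) * w' s +
          ρ / G.r * ∫ v in u₀..u s (w s), G.f v / G.e v * G.expFactor ρ u₀ v) -
        Real.exp (-ρ * (s - t)) * (G.expFactor ρ u₀ (u s (z s)) * z' s +
          ρ / G.r * ∫ v in u₀..u s (z s), G.f v / G.e v * G.expFactor ρ u₀ v)) =
      Real.exp (-ρ * (T - t)) * ∫ x in z T..w T, G.expFactor ρ u₀ (u T x) := by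
  have hIT : Icc t T ⊆ Icc 0 T := Icc_subset_Icc_left ht.1
  have hr := hG.r_pos.ne'
  set X := G.expFactor ρ u₀ with hX
  have hXd : ∀ a ∈ G.U, HasDerivAt X (-(ρ / G.r) / G.e a * X a) a := fun a ha =>
    hasDerivAt_expFactor hV hu₀ ρ (hV.subset ha)
  have hXc : ContinuousOn X G.U := (continuousOn_expFactor hV hu₀ ρ).mono hV.subset
  set ξ : ℝ → ℝ → ℝ := fun s θ => z s + θ * (w s - z s) with hξ
  set ξ' : ℝ → ℝ → ℝ := fun s θ => z' s + θ * (w' s - z' s) with hξ'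
  have hpos : ∀ s ∈ Icc t T, ∀ θ ∈ Icc (0 : ℝ) 1, ξ s θ ∈ Ioi (0 : ℝ) := fun s hs θ hθ => by
    have h1 := (hz s hs).1
    have h2 := (hw s hs).1
    have : ξ s θ = (1 - θ) * z s + θ * w s := by simp only [hξ]; ring
    rw [this, mem_Ioi]
    rcases hθ.1.eq_or_lt with h0 | h0
    · rw [← h0]; simpa using h1
    · have := mul_nonneg (sub_nonneg.2 hθ.2) h1.le
      have := mul_pos h0 h2
      linarith
  have hzc : ContinuousOn z (Icc t T) := fun s hs => (hz s hs).2.continuousWithinAt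
  have hwc : ContinuousOn w (Icc t T) := fun s hs => (hw s hs).2.continuousWithinAt
  have key := integral_sub_eq_of_mixed_partials ht.2
    (F := fun s θ => Real.exp (-ρ * (s - t)) * ((w s - z s) * X (u s (ξ s θ))))
    (H := fun s θ => Real.exp (-ρ * (s - t)) * (X (u s (ξ s θ)) * ξ' s θ +
      ρ / G.r * ∫ v in u₀..u s (ξ s θ), G.f v / G.e v * X v))
    (Q := fun s θ => Real.exp (-ρ * (s - t)) * ((w' s - z' s) * X (u s (ξ s θ)) +
      (w s - z s) * (X (u s (ξ s θ)) * ux s (ξ s θ) * (ρ / G.r / G.e (u s (ξ s θ)) *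
        (G.f (u s (ξ s θ)) - ξ' s θ)))))
    (by
      have c1 : ContinuousOn (fun q : ℝ × ℝ => z q.1) (Icc t T ×ˢ Icc 0 1) :=
        hzc.comp continuousOn_fst fun q hq => hq.1
      have c2 : ContinuousOn (fun q : ℝ × ℝ => w q.1) (Icc t T ×ˢ Icc 0 1) :=
        hwc.comp continuousOn_fst fun q hq => hq.1
      have c3 : ContinuousOn (fun q : ℝ × ℝ => z' q.1) (Icc t T ×ˢ Icc 0 1) :=
        hz'.comp continuousOn_fst fun q hq => hq.1
      have c4 : ContinuousOn (fun q : ℝ × ℝ => w' q.1) (Icc t T ×ˢ Icc 0 1) :=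
        hw'.comp continuousOn_fst fun q hq => hq.1
      have c5 : ContinuousOn (fun q : ℝ × ℝ => (q.1, ξ q.1 q.2)) (Icc t T ×ˢ Icc 0 1) :=
        continuousOn_fst.prodMk (c1.add (continuousOn_snd.mul (c2.sub c1)))
      have m5 : MapsTo (fun q : ℝ × ℝ => (q.1, ξ q.1 q.2)) (Icc t T ×ˢ Icc 0 1)
          (Icc 0 T ×ˢ Ioi 0) := fun q hq => ⟨hIT hq.1, hpos _ hq.1 _ hq.2⟩
      have c6 : ContinuousOn (fun q : ℝ × ℝ => u q.1 (ξ q.1 q.2)) (Icc t T ×ˢ Icc 0 1) :=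
        h.continuousOn.comp c5 m5
      have m6 : MapsTo (fun q : ℝ × ℝ => u q.1 (ξ q.1 q.2)) (Icc t T ×ˢ Icc 0 1) G.U :=
        fun q hq => huU _ (hIT hq.1) _ (hpos _ hq.1 _ hq.2)
      have c7 : ContinuousOn (fun q : ℝ × ℝ => ux q.1 (ξ q.1 q.2)) (Icc t T ×ˢ Icc 0 1) :=
        h.continuousOn_state.comp c5 m5
      have c8 := hXc.comp c6 m6
      have c9 := (hV.continuousOn_f.mono hV.subset).comp c6 m6
      have c10 := (hV.continuousOn_e.mono hV.subset).comp c6 m6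
      exact ContinuousOn.mul (by fun_prop) (((c4.sub c3).mul c8).add ((c2.sub c1).mul
        ((c8.mul c7).mul ((continuousOn_const.div c10 fun q hq => (hG.e_pos (m6 hq)).ne').mul
          (c9.sub (c3.add (continuousOn_snd.mul (c4.sub c3)))))))))
    (fun θ hθ s hs => by
      have d1 : HasDerivWithinAt (fun s => Real.exp (-ρ * (s - t)))
          (Real.exp (-ρ * (s - t)) * -ρ) (Icc t T) s := by
        have := (((hasDerivAt_id s).sub_const t).const_mul (-ρ)).exp
        simpa using this.hasDerivWithinAt
      have d2 := (hw s hs).2.sub (hz s hs).2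
      have d3 : HasDerivWithinAt (fun s => ξ s θ) (ξ' s θ) (Icc t T) s :=
        (hz s hs).2.add (d2.const_mul θ)
      have d4 := h.hasDerivWithinAt_comp hs (fun τ hτ => ⟨hIT hτ, hpos τ hτ θ hθ⟩) d3
      have hmem := huU s (hIT hs) _ (hpos s hs θ hθ)
      have d5 := (hXd _ hmem).comp_hasDerivWithinAt s d4
      refine (d1.mul (d2.mul d5)).congr_deriv ?_
      have he := (hG.e_pos hmem).ne'
      have hp := hpde s (hIT hs) _ (hpos s hs θ hθ)
      have hut : ut s (ξ s θ) = -G.r * G.e (u s (ξ s θ)) - G.f (u s (ξ s θ)) * ux s (ξ s θ) := by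
        linarith
      rw [hut]
      simp only [Function.comp_apply, Pi.mul_apply, Pi.sub_apply]
      field_simp
      ring)
    (fun s hs θ hθ => by
      have d1 : HasDerivAt (fun θ => ξ s θ) (w s - z s) θ := by
        exact (((hasDerivAt_id θ).mul_const (w s - z s)).const_add (z s)).congr_deriv (one_mul _)
      have d2 : HasDerivAt (fun θ => ξ' s θ) (w' s - z' s) θ := by
        exact (((hasDerivAt_id θ).mul_const (w' s - z' s)).const_add (z' s)).congr_deriv
          (one_mul _)
      have hmem := huU s (hIT hs) _ (hpos s hs θ hθ)
      have d3 : HasDerivAt (fun θ => u s (ξ s θ)) (ux s (ξ s θ) * (w s - z s)) θ :=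
        (h.hasDerivAt_state (hIT hs) (hpos s hs θ hθ)).comp θ d1
      have d4 := (hXd _ hmem).comp θ d3
      have d5 := (hasDerivAt_integral_expFactor hV hu₀ ρ (hV.subset hmem)).comp θ d3
      refine (((d4.mul d2).add (d5.const_mul (ρ / G.r))).const_mul
        (Real.exp (-ρ * (s - t)))).hasDerivWithinAt.congr_deriv ?_
      simp only [Function.comp_apply]
      ring)
  have hξ0 : ∀ s, ξ s 0 = z s := fun s => by simp only [hξ]; ring
  have hξ1 : ∀ s, ξ s 1 = w s := fun s => by simp only [hξ]; ring
  have hξ'0 : ∀ s, ξ' s 0 = z' s := fun s => by simp only [hξ']; ring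
  have hξ'1 : ∀ s, ξ' s 1 = w' s := fun s => by simp only [hξ']; ring
  simp only [hξ0, hξ1, hξ'0, hξ'1] at key
  rw [key]
  have hF : ∀ θ, Real.exp (-ρ * (T - t)) * ((w T - z T) * X (u T (ξ T θ))) -
      Real.exp (-ρ * (t - t)) * ((w t - z t) * X (u t (ξ t θ))) =
      Real.exp (-ρ * (T - t)) * ((w T - z T) * X (u T (z T + (w T - z T) * θ))) := fun θ => by
    rw [hstart, sub_self (z t), zero_mul, mul_zero, sub_zero, mul_comm (w T - z T) θ]
  simp only [hF]
  rw [intervalIntegral.integral_const_mul, intervalIntegral.integral_const_mul,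
    intervalIntegral.mul_integral_comp_add_mul (f := fun x => X (u T x))]
  simp

/-- A rule that solves `u_t + f(u) u_x = -r e₁(u)` is optimal for the fictitious monopoly: the
pointwise maximum condition `ell_sub_le`, integrated with `integral_costate_eq`, bounds the gain in
payoff flow by the loss in bequest. -/
theorem isOptimal_of_equation (hG : G.Standard) (hf : ContDiffOn ℝ 2 G.f G.U) {T : ℝ}
    (hT : 0 < T) {u ut ux : ℝ → ℝ → ℝ} (h : HasPartials T u ut ux)
    (hpde : ∀ t ∈ Icc 0 T, ∀ x ∈ Ioi (0 : ℝ),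
      ut t x + G.f (u t x) * ux t x = -G.r * G.e (u t x))
    (hadm : Admissible G.f T G.U u) {C : ℝ} (hC : ∀ a ∈ G.U, 0 ≤ C * derivWithin G.f G.U a)
    {ρ : ℝ} (hρ : 0 ≤ ρ) {x₀ : ℝ} (hx₀ : x₀ ∈ Ioi (0 : ℝ)) (c₁ c₂ : ℝ) :
    (Monopoly.mk (G.ell ρ C c₁ (u T x₀)) ρ G.f (G.bequest ρ C c₂ (u T) x₀)).IsOptimal T G.U u := by
  refine ⟨hadm, fun v hv t ht x hx w z hw hz => ?_⟩
  dsimp only at hw hz ⊢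
  have hTT : T ∈ Icc 0 T := right_mem_Icc.2 hT.le
  have huU := hadm.1.2
  have hIT : Icc t T ⊆ Icc 0 T := Icc_subset_Icc_left ht.1
  obtain ⟨V, hV⟩ := hG.exists_regularInterval ⟨_, huU T hTT x₀ hx₀⟩
  set u₀ := u T x₀ with hu₀
  have hu₀V : u₀ ∈ V := hV.subset (huU T hTT x₀ hx₀)
  set X := G.expFactor ρ u₀ with hX
  have hfc : ContinuousOn G.f G.U := hf.continuousOn
  have hfd : DifferentiableOn ℝ G.f G.U := hf.differentiableOn (by norm_num)
  have hℓc : ContinuousOn (G.ell ρ C c₁ u₀) G.U := fun a ha =>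
    (hasDerivWithinAt_ell hV hu₀V hfd ρ C c₁ ha).continuousWithinAt
  have hXc : ContinuousOn X G.U := (continuousOn_expFactor hV hu₀V ρ).mono hV.subset
  set K : ℝ → ℝ := fun a => ∫ v in u₀..a, G.f v / G.e v * X v with hK
  have hKc : ContinuousOn K G.U := fun a ha =>
    (hasDerivAt_integral_expFactor hV hu₀V ρ (hV.subset ha)).continuousAt.continuousWithinAt
  have hzc : ContinuousOn z (Icc t T) := fun s hs => (hz.2 s hs).2.continuousWithinAt
  have hwc : ContinuousOn w (Icc t T) := fun s hs => (hw.2 s hs).2.continuousWithinAt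
  have cz : ContinuousOn (fun s => u s (z s)) (Icc t T) :=
    h.continuousOn.comp (continuousOn_id.prodMk hzc) fun s hs => ⟨hIT hs, (hz.2 s hs).1⟩
  have cw : ContinuousOn (fun s => u s (w s)) (Icc t T) :=
    h.continuousOn.comp (continuousOn_id.prodMk hwc) fun s hs => ⟨hIT hs, (hw.2 s hs).1⟩
  have cv : ContinuousOn (fun s => v s (w s)) (Icc t T) :=
    hv.1.continuousOn.comp (continuousOn_id.prodMk hwc) fun s hs => ⟨hIT hs, (hw.2 s hs).1⟩
  have mz : MapsTo (fun s => u s (z s)) (Icc t T) G.U := fun s hs => huU s (hIT hs) _ (hz.2 s hs).1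
  have mw : MapsTo (fun s => u s (w s)) (Icc t T) G.U := fun s hs => huU s (hIT hs) _ (hw.2 s hs).1
  have mv : MapsTo (fun s => v s (w s)) (Icc t T) G.U := fun s hs =>
    hv.2 s (hIT hs) _ (hw.2 s hs).1
  have cE : ContinuousOn (fun s => Real.exp (-ρ * (s - t))) (Icc t T) := by fun_prop
  have key := integral_costate_eq hG h huU hpde hV hu₀V ρ ht (hw.1.trans hz.1.symm) hz.2 hw.2
    (hfc.comp cz mz) (hfc.comp cv mv)
  have hIcc : uIcc t T = Icc t T := uIcc_of_le ht.2
  have i1 : IntervalIntegrable (fun s => Real.exp (-ρ * (s - t)) * G.ell ρ C c₁ u₀ (v s (w s)))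
      volume t T := (hIcc ▸ cE.mul (hℓc.comp cv mv) : ContinuousOn _ (uIcc t T)).intervalIntegrable
  have i2 : IntervalIntegrable (fun s => Real.exp (-ρ * (s - t)) * G.ell ρ C c₁ u₀ (u s (z s)))
      volume t T := (hIcc ▸ cE.mul (hℓc.comp cz mz) : ContinuousOn _ (uIcc t T)).intervalIntegrable
  have i3 : IntervalIntegrable (fun s =>
      Real.exp (-ρ * (s - t)) * (X (u s (w s)) * G.f (v s (w s)) + ρ / G.r * K (u s (w s))) -
      Real.exp (-ρ * (s - t)) * (X (u s (z s)) * G.f (u s (z s)) + ρ / G.r * K (u s (z s))))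
      volume t T :=
    (hIcc ▸ (cE.mul (((hXc.comp cw mw).mul (hfc.comp cv mv)).add
        (continuousOn_const.mul (hKc.comp cw mw)))).sub
      (cE.mul (((hXc.comp cz mz).mul (hfc.comp cz mz)).add
        (continuousOn_const.mul (hKc.comp cz mz)))) :
      ContinuousOn _ (uIcc t T)).intervalIntegrable
  have hle := intervalIntegral.integral_mono_on ht.2 (i1.sub i2) (i3.const_mul C) fun s hs => by
    have h1 := ell_sub_le hV hu₀V hG hfd hρ hC c₁ (mw hs) (mv hs)
    have h2 : ∀ a, G.ell ρ C c₁ u₀ a = C * G.f a * X a + C * (ρ / G.r) * K a + c₁ := fun _ => rfl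
    have hE := Real.exp_pos (-ρ * (s - t))
    rw [h2 (u s (w s))] at h1
    rw [← mul_sub, ← mul_sub, mul_left_comm]
    refine mul_le_mul_of_nonneg_left ?_ hE.le
    rw [h2 (u s (z s))]
    linarith
  rw [intervalIntegral.integral_sub i1 i2, intervalIntegral.integral_const_mul] at hle
  have hb : G.bequest ρ C c₂ (u T) x₀ (w T) - G.bequest ρ C c₂ (u T) x₀ (z T) =
      -C * ∫ x in z T..w T, X (u T x) := by
    have hzT := (hz.2 T (right_mem_Icc.2 ht.2)).1
    have hwT := (hw.2 T (right_mem_Icc.2 ht.2)).1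
    have hsub : uIcc (z T) (w T) ⊆ Ioi 0 := ordConnected_Ioi.uIcc_subset hzT hwT
    have hφ : ContDiffOn ℝ 1 (u T) (Ioi 0) :=
      hadm.1.1.comp (f := fun x : ℝ => (T, x)) (contDiff_const.prodMk contDiff_id).contDiffOn
        fun x hx => ⟨hTT, hx⟩
    rw [← intervalIntegral.integral_const_mul]
    refine (intervalIntegral.integral_eq_sub_of_hasDerivAt (fun x hx =>
      hasDerivAt_bequest hV hφ (fun x hx => hV.subset (huU T hTT x hx)) hx₀ ρ C c₂ (hsub hx))
      ?_).symm
    exact ((hXc.comp hφ.continuousOn fun x hx =>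
      huU T hTT x hx).mono hsub).intervalIntegrable.const_mul (-C)
  have hfin := (congrArg (fun q => C * q) key).symm
  dsimp only [payoff]
  have hE := congrArg (fun q => Real.exp (-ρ * (T - t)) * q) hb
  linarith

end Oligopoly

/-! ### Verification on the infinite horizon -/

theorem not_forall_deriv_le_neg {y y' : ℝ → ℝ} {c : ℝ} (hc : 0 < c)
    (hy : ∀ s ∈ Ici (0 : ℝ), 0 < y s ∧ HasDerivWithinAt y (y' s) (Ici 0) s) :
    ¬ ∀ s ∈ Ici (0 : ℝ), y' s ≤ -c := by
  intro h
  have hanti : AntitoneOn (fun s => y s + c * s) (Ici 0) := by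
    have hd : ∀ s ∈ Ici (0 : ℝ), HasDerivWithinAt (fun s => y s + c * s) (y' s + c * 1) (Ici 0) s :=
      fun s hs => (hy s hs).2.add ((hasDerivWithinAt_id s _).const_mul c)
    refine antitoneOn_of_hasDerivWithinAt_nonpos (convex_Ici 0)
      (fun s hs => (hd s hs).continuousWithinAt)
      (fun s hs => (hd s (interior_subset hs)).mono interior_subset) fun s hs => ?_
    have := h s (interior_subset hs)
    linarith
  have h0 : (0 : ℝ) ∈ Ici (0 : ℝ) := self_mem_Ici
  have hS : y 0 / c ∈ Ici (0 : ℝ) := (div_pos (hy 0 h0).1 hc).le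
  have h1 := hanti h0 hS hS
  have h2 := (hy _ hS).1
  simp only [mul_zero, add_zero] at h1
  rw [mul_div_cancel₀ _ hc.ne'] at h1
  linarith

theorem antitoneOn_of_deriv_nonpos_Ici {y y' : ℝ → ℝ}
    (hy : ∀ s ∈ Ici (0 : ℝ), HasDerivWithinAt y (y' s) (Ici 0) s)
    (h : ∀ s ∈ Ici (0 : ℝ), y' s ≤ 0) : AntitoneOn y (Ici 0) :=
  antitoneOn_of_hasDerivWithinAt_nonpos (convex_Ici 0)
    (fun s hs => (hy s hs).continuousWithinAt)
    (fun s hs => (hy s (interior_subset hs)).mono interior_subset)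
    fun s hs => h s (interior_subset hs)

/-- An autonomous flow on `(0, ∞)` with negative velocity and no rest point tends to `0`. -/
theorem tendsto_zero_of_velocity_neg {g z : ℝ → ℝ} (hg : ContinuousOn g (Ioi 0))
    (hneg : ∀ x ∈ Ioi (0 : ℝ), g x < 0)
    (hz : ∀ s ∈ Ici (0 : ℝ), 0 < z s ∧ HasDerivWithinAt z (g (z s)) (Ici 0) s) :
    Filter.Tendsto z Filter.atTop (nhds 0) := by
  have hanti : AntitoneOn z (Ici 0) := antitoneOn_of_deriv_nonpos_Ici (fun s hs => (hz s hs).2)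
    fun s hs => (hneg _ (hz s hs).1).le
  refine tendsto_order.2 ⟨fun δ hδ => ?_, fun δ hδ => ?_⟩
  · filter_upwards [Filter.eventually_ge_atTop 0] with s hs
    exact hδ.trans (hz s hs).1
  · obtain ⟨s₀, hs₀, hlt⟩ : ∃ s₀ ∈ Ici (0 : ℝ), z s₀ < δ := by
      by_contra! hge
      have hsub : Icc δ (z 0) ⊆ Ioi 0 := fun ξ hξ => hδ.trans_le hξ.1
      obtain ⟨m, hm, hmax⟩ := isCompact_Icc.exists_isMaxOn
        ⟨δ, left_mem_Icc.2 (hge 0 self_mem_Ici)⟩ (hg.mono hsub)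
      exact not_forall_deriv_le_neg (neg_pos.2 (hneg m (hsub hm))) hz fun s hs => by
        rw [neg_neg]
        exact hmax ⟨hge s hs, hanti self_mem_Ici hs hs⟩
    filter_upwards [Filter.eventually_ge_atTop s₀] with s hs
    exact (hanti hs₀ (hs₀.trans hs : (0 : ℝ) ≤ s) hs).trans_lt hlt

theorem eqOn_const_of_hasDerivWithinAt_zero {g : ℝ → ℝ}
    (hg : ∀ s ∈ Ici (0 : ℝ), HasDerivWithinAt g 0 (Ici 0) s) : ∀ s ∈ Ici (0 : ℝ), g s = g 0 :=
  fun s hs => constant_of_has_deriv_right_zero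
    (fun τ hτ => (hg τ hτ.1).continuousWithinAt.mono Icc_subset_Ici_self)
    (fun τ hτ => (hg τ hτ.1).mono (Ici_subset_Ici.2 hτ.1)) s (right_mem_Icc.2 hs)

theorem intervalIntegral_eq_sub_of_hasDerivWithinAt_Ici {g g' : ℝ → ℝ}
    (hg : ∀ s ∈ Ici (0 : ℝ), HasDerivWithinAt g (g' s) (Ici 0) s)
    (hg' : ContinuousOn g' (Ici 0)) {S : ℝ} (hS : 0 ≤ S) :
    ∫ s in (0 : ℝ)..S, g' s = g S - g 0 :=
  intervalIntegral.integral_eq_sub_of_hasDerivAt_of_le hS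
    (fun s hs => (hg s hs.1).continuousWithinAt.mono Icc_subset_Ici_self)
    (fun s hs => (hg s hs.1.le).hasDerivAt (Ici_mem_nhds hs.1))
    (hg'.mono (by rw [uIcc_of_le hS]; exact Icc_subset_Ici_self)).intervalIntegrable

/-- If `A ≤ 0` solves `A' = -ρ A + g` with `A(0) = 0` and the integrals of `g` are bounded below,
then `A` is integrable. -/
theorem integrableOn_of_linear_equation {A g : ℝ → ℝ} {ρ I : ℝ} (hρ : 0 < ρ)
    (hA : ∀ s ∈ Ici (0 : ℝ), HasDerivWithinAt A (-ρ * A s + g s) (Ici 0) s)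
    (hg : ContinuousOn g (Ici 0)) (hA0 : A 0 = 0) (hneg : ∀ s ∈ Ici (0 : ℝ), A s ≤ 0)
    (hI : ∀ S ∈ Ici (0 : ℝ), -I ≤ ∫ s in (0 : ℝ)..S, g s) : IntegrableOn A (Ioi 0) := by
  have hAc : ContinuousOn A (Ici 0) := fun s hs => (hA s hs).continuousWithinAt
  refine integrableOn_Ioi_of_intervalIntegral_norm_bounded (I / ρ) 0 (l := Filter.atTop)
    (b := fun S : ℝ => S) (fun S => ?_) Filter.tendsto_id ?_
  · exact ((hAc.mono Icc_subset_Ici_self).integrableOn_compact isCompact_Icc).mono_set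
      Ioc_subset_Icc_self
  · filter_upwards [Filter.eventually_ge_atTop 0] with S hS
    have hsub : uIcc 0 S ⊆ Ici 0 := by rw [uIcc_of_le hS]; exact Icc_subset_Ici_self
    have h1 := intervalIntegral_eq_sub_of_hasDerivWithinAt_Ici hA
      ((continuousOn_const.mul hAc).add hg) hS
    have i1 : IntervalIntegrable (fun s => -ρ * A s) volume 0 S :=
      (hAc.mono hsub).intervalIntegrable.const_mul (-ρ)
    rw [intervalIntegral.integral_add i1 (hg.mono hsub).intervalIntegrable, intervalIntegral.integral_const_mul, hA0] at h1
    have h2 : ∫ s in (0 : ℝ)..S, ‖A s‖ = -∫ s in (0 : ℝ)..S, A s := by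
      rw [← intervalIntegral.integral_neg]
      refine intervalIntegral.integral_congr fun s hs => ?_
      exact Real.norm_of_nonpos (hneg s (hsub hs))
    have h3 := hneg S hS
    have h4 := hI S hS
    rw [h2, le_div_iff₀ hρ]
    linarith

namespace Oligopoly

variable {N : ℕ} [NeZero N] {G : Oligopoly N}

section Stationary

variable (hG : G.Standard) {u : ℝ → ℝ} (hc : ContDiffOn ℝ 1 u (Ioi 0))
  (hode : ∀ x ∈ Ioi (0 : ℝ), G.f (u x) * deriv u x = -G.r * G.e (u x))

include hG hc hode

/-- The monopoly extracts, `f(u) < 0`. By `f(u) u' = -r e₁(u)` the sign of `f(u)` is constant and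
opposite to that of `u'`. If it were positive, the equilibrium rates would increase as the stock
falls, and the stock of the oligopoly would be exhausted in finite time. -/
theorem f_neg_of_equation (hint : ∀ x ∈ Ioi (0 : ℝ), u x ∈ interior G.U)
    (hadm : StatAdmissible dyn G.profiles (fun x (_ : Fin N) => u x)) :
    ∀ x ∈ Ioi (0 : ℝ), G.f (u x) < 0 := by
  have h_one : (1 : ℝ) ∈ Ioi (0 : ℝ) := mem_Ioi.2 one_pos
  have hU : ∀ x ∈ Ioi (0 : ℝ), u x ∈ G.U := fun x hx => interior_subset (hint x hx)
  obtain ⟨V, hV⟩ := hG.exists_regularInterval ⟨_, hU 1 h_one⟩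
  have hfu : ContinuousOn (fun x => G.f (u x)) (Ioi 0) :=
    hV.continuousOn_f.comp hc.continuousOn fun x hx => hV.subset (hU x hx)
  have hrhs : ∀ x ∈ Ioi (0 : ℝ), -G.r * G.e (u x) < 0 := fun x hx => by
    have := mul_pos hG.r_pos (hG.e_pos (hU x hx))
    linarith
  have hne : ∀ x ∈ Ioi (0 : ℝ), G.f (u x) ≠ 0 := fun x hx h0 => by
    have h1 := hode x hx
    have h2 := hrhs x hx
    rw [h0, zero_mul] at h1
    linarith
  by_contra! hcon
  obtain ⟨x₁, hx₁, hge⟩ := hcon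
  have hpos : ∀ x ∈ Ioi (0 : ℝ), 0 < G.f (u x) := fun x hx => by
    by_contra! hle
    obtain ⟨x₂, hx₂, h0⟩ := isPreconnected_Ioi.intermediate_value hx hx₁ hfu ⟨hle, hge⟩
    exact hne x₂ hx₂ h0
  have hanti : AntitoneOn u (Ioi 0) := by
    refine antitoneOn_of_deriv_nonpos (convex_Ioi 0) hc.continuousOn
      ((hc.differentiableOn (by norm_num)).mono interior_subset) fun x hx => ?_
    have hx := interior_subset hx
    have h1 := hode x hx
    have h2 := hrhs x hx
    have h3 := hpos x hx
    by_contra! h4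
    have := mul_pos h3 h4
    linarith
  obtain ⟨y, hy0, hy⟩ := (hadm.2 1 h_one).1
  simp only [dyn_const] at hy
  have hNpos : (0 : ℝ) < N := by exact_mod_cast NeZero.pos N
  have hupos : ∀ x ∈ Ioi (0 : ℝ), 0 < u x := fun x hx => hG.pos_of_mem_interior (hint x hx)
  have hyanti : AntitoneOn y (Ici 0) := antitoneOn_of_deriv_nonpos_Ici (fun s hs => (hy s hs).2)
    fun s hs => by
      have := mul_pos hNpos (hupos _ (hy s hs).1)
      linarith
  refine not_forall_deriv_le_neg (mul_pos hNpos (hupos 1 h_one)) hy fun s hs => ?_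
  have h1 : y s ≤ 1 := hy0 ▸ hyanti self_mem_Ici hs hs
  have h2 := mul_le_mul_of_nonneg_left (hanti (hy s hs).1 h_one h1) hNpos.le
  linarith

/-- If `C` were positive, `f` would be increasing. As `u` increases in the stock, the monopoly would
then extract ever faster as the stock falls and exhaust it in finite time. -/
theorem const_nonpos_of_equation (hf : DifferentiableOn ℝ G.f G.U)
    (hneg : ∀ x ∈ Ioi (0 : ℝ), G.f (u x) < 0) (hadm : StatAdmissible G.f G.U u) {C : ℝ}
    (hC : ∀ a ∈ G.U, 0 ≤ C * derivWithin G.f G.U a) : C ≤ 0 := by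
  by_contra! hCpos
  have h_one : (1 : ℝ) ∈ Ioi (0 : ℝ) := mem_Ioi.2 one_pos
  have hU : ∀ x ∈ Ioi (0 : ℝ), u x ∈ G.U := hadm.1.2
  have hmono : MonotoneOn G.f G.U :=
    monotoneOn_of_hasDerivWithinAt_nonneg hG.U_interval.convex hf.continuousOn
      (fun a ha => (hf a (interior_subset ha)).hasDerivWithinAt.mono interior_subset)
      fun a ha => nonneg_of_mul_nonneg_right (hC a (interior_subset ha)) hCpos
  have humono : MonotoneOn u (Ioi 0) := by
    refine monotoneOn_of_deriv_nonneg (convex_Ioi 0) hc.continuousOn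
      ((hc.differentiableOn (by norm_num)).mono interior_subset) fun x hx => ?_
    have hx := interior_subset hx
    have h1 := hode x hx
    have h2 := mul_pos hG.r_pos (hG.e_pos (hU x hx))
    have h3 := hneg x hx
    by_contra! h4
    have := mul_pos_of_neg_of_neg h3 h4
    linarith
  obtain ⟨z, hz0, hz⟩ := (hadm.2 1 h_one).1
  have hzanti : AntitoneOn z (Ici 0) := antitoneOn_of_deriv_nonpos_Ici (fun s hs => (hz s hs).2)
    fun s hs => (hneg _ (hz s hs).1).le
  refine not_forall_deriv_le_neg (neg_pos.2 (hneg 1 h_one)) hz fun s hs => ?_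
  have h1 : z s ≤ 1 := hz0 ▸ hzanti self_mem_Ici hs hs
  rw [neg_neg]
  exact hmono (hU _ (hz s hs).1) (hU 1 h_one) (humono (hz s hs).1 h_one h1)

/-- The discounted costate is constant along the trajectories of `u`. -/
theorem exp_mul_expFactor_eq (hU : ∀ x ∈ Ioi (0 : ℝ), u x ∈ G.U) {V : Set ℝ} (hV : G.RegularInterval V) {u₀ : ℝ} (hu₀ : u₀ ∈ V) (ρ : ℝ) {x : ℝ} {z : ℝ → ℝ}
    (hz : IsStatTrajectory G.f u x z) {s : ℝ} (hs : s ∈ Ici (0 : ℝ)) :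
    Real.exp (-ρ * s) * G.expFactor ρ u₀ (u (z s)) = G.expFactor ρ u₀ (u x) := by
  have h := eqOn_const_of_hasDerivWithinAt_zero
    (g := fun s => Real.exp (-ρ * s) * G.expFactor ρ u₀ (u (z s))) (fun s hs => by
      have hzs := (hz.2 s hs).1
      have d1 : HasDerivAt (fun s => Real.exp (-ρ * s)) (Real.exp (-ρ * s) * -ρ) s := by
        simpa using ((hasDerivAt_id s).const_mul (-ρ)).exp
      have d2 : HasDerivAt u (deriv u (z s)) (z s) :=
        ((hc.differentiableOn (by norm_num)).differentiableAt
          (isOpen_Ioi.mem_nhds hzs)).hasDerivAt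
      have d3 := (hasDerivAt_expFactor hV hu₀ ρ (hV.subset (hU _ hzs))).comp_hasDerivWithinAt s
        (d2.comp_hasDerivWithinAt s (hz.2 s hs).2)
      refine (d1.hasDerivWithinAt.mul d3).congr_deriv ?_
      have he := (hG.e_pos (hU _ hzs)).ne'
      have hr := hG.r_pos.ne'
      have hp := hode _ hzs
      simp only [Function.comp_apply]
      rw [mul_comm (deriv u (z s)), hp]
      field_simp
      ring) s hs
  simpa [hz.1] using h

/-- A stationary rule with `f(u) u' = -r e₁(u)` and `f(u) < 0` is optimal for the fictitious
monopoly. Its payoff converges because `ℓ(u)` is, after discounting, the sum of the integrable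
velocity times a constant and of a solution of a stable linear equation driven by the velocity. -/
theorem isStatOptimal_of_equation (hf : ContDiffOn ℝ 2 G.f G.U)
    (hneg : ∀ x ∈ Ioi (0 : ℝ), G.f (u x) < 0) (hadm : StatAdmissible G.f G.U u) {C : ℝ}
    (hC : ∀ a ∈ G.U, 0 ≤ C * derivWithin G.f G.U a) {ρ : ℝ} (hρ : 0 < ρ) {u₀ : ℝ}
    (hu₀ : u₀ ∈ G.U) (c : ℝ) :
    (Monopoly.mk (G.ell ρ C c u₀) ρ G.f fun _ => 0).IsStatOptimal G.U u := by
  refine ⟨hadm, fun x hx z hz => ?_⟩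
  dsimp only at hz ⊢
  have hU : ∀ x ∈ Ioi (0 : ℝ), u x ∈ G.U := hadm.1.2
  obtain ⟨V, hV⟩ := hG.exists_regularInterval ⟨_, hu₀⟩
  have hu₀V : u₀ ∈ V := hV.subset hu₀
  have hfd : DifferentiableOn ℝ G.f G.U := hf.differentiableOn (by norm_num)
  have hC0 : C ≤ 0 := const_nonpos_of_equation hG hc hode hfd hneg hadm hC
  set X := G.expFactor ρ u₀ with hX
  set X₀ := X (u x) with hX₀
  have hX₀pos : 0 < X₀ := expFactor_pos ρ u₀ _
  have hCX : C * X₀ ≤ 0 := mul_nonpos_of_nonpos_of_nonneg hC0 hX₀pos.le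
  have hXconst : ∀ s ∈ Ici (0 : ℝ), Real.exp (-ρ * s) * X (u (z s)) = X₀ := fun s hs =>
    exp_mul_expFactor_eq hG hc hode hU hV hu₀V ρ hz hs
  have hfu : ContinuousOn (fun x => G.f (u x)) (Ioi 0) := hf.continuousOn.comp hc.continuousOn hU
  have hz0 : Filter.Tendsto z Filter.atTop (nhds 0) := tendsto_zero_of_velocity_neg hfu hneg hz.2
  have hzc : ContinuousOn z (Ici 0) := fun s hs => (hz.2 s hs).2.continuousWithinAt
  have hz' : ContinuousOn (fun s => G.f (u (z s))) (Ici 0) :=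
    hfu.comp hzc fun s hs => (hz.2 s hs).1
  have hz'i : IntegrableOn (fun s => G.f (u (z s))) (Ioi 0) :=
    integrableOn_Ioi_deriv_of_nonpos (hzc 0 self_mem_Ici)
      (fun s hs => (hz.2 s (Ioi_subset_Ici_self hs)).2.hasDerivAt (Ici_mem_nhds hs))
      (fun s hs => (hneg _ (hz.2 s (Ioi_subset_Ici_self hs)).1).le) hz0
  set k : ℝ → ℝ := fun s => C * (ρ / G.r) * ∫ v in u₀..u (z s), G.f v / G.e v * X v with hk
  have hkd : ∀ s ∈ Ici (0 : ℝ),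
      HasDerivWithinAt k (-(C * ρ * (G.f (u (z s)) * X (u (z s))))) (Ici 0) s := fun s hs => by
    have hzs := (hz.2 s hs).1
    have d2 : HasDerivAt u (deriv u (z s)) (z s) :=
      ((hc.differentiableOn (by norm_num)).differentiableAt
        (isOpen_Ioi.mem_nhds hzs)).hasDerivAt
    have d3 := (hasDerivAt_integral_expFactor hV hu₀V ρ
      (hV.subset (hU _ hzs))).comp_hasDerivWithinAt s (d2.comp_hasDerivWithinAt s (hz.2 s hs).2)
    refine (d3.const_mul (C * (ρ / G.r))).congr_deriv ?_
    have he := (hG.e_pos (hU _ hzs)).ne'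
    have hr := hG.r_pos.ne'
    rw [← hX, mul_comm (deriv u (z s)), hode _ hzs]
    field_simp
  have hkanti : AntitoneOn k (Ici 0) := antitoneOn_of_deriv_nonpos_Ici hkd fun s hs => by
    have h1 := mul_nonneg_of_nonpos_of_nonpos hC0 (hneg _ (hz.2 s hs).1).le
    have h2 := mul_nonneg (mul_nonneg h1 hρ.le) (expFactor_pos (G := G) ρ u₀ (u (z s))).le
    linarith
  set A : ℝ → ℝ := fun s => Real.exp (-ρ * s) * (k s - k 0) with hA
  have hAi : IntegrableOn A (Ioi 0) := by
    refine integrableOn_of_linear_equation (g := fun s => -(C * X₀ * ρ) * G.f (u (z s)))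
      (I := -(C * X₀ * ρ) * x) hρ (fun s hs => ?_) (continuousOn_const.mul hz') (by simp [hA])
      (fun s hs => ?_) fun S hS => ?_
    · have d1 : HasDerivAt (fun s => Real.exp (-ρ * s)) (Real.exp (-ρ * s) * -ρ) s := by
        simpa using ((hasDerivAt_id s).const_mul (-ρ)).exp
      refine (d1.hasDerivWithinAt.mul ((hkd s hs).sub_const (k 0))).congr_deriv ?_
      have := hXconst s hs
      simp only [hA]
      linear_combination (-(C * ρ * G.f (u (z s)))) * this
    · exact mul_nonpos_of_nonneg_of_nonpos (Real.exp_pos _).le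
        (sub_nonpos.2 (hkanti self_mem_Ici hs hs))
    · rw [intervalIntegral.integral_const_mul,
        intervalIntegral_eq_sub_of_hasDerivWithinAt_Ici (fun s hs => (hz.2 s hs).2) hz' hS, hz.1]
      have h1 := (hz.2 S hS).1
      have h2 := mul_nonneg (mul_nonneg (neg_nonneg.2 hCX) hρ.le) h1.le
      linarith
  have hconv : StatConverges (G.ell ρ C c u₀) ρ u z := by
    have h1 : IntegrableOn (fun s => A s + Real.exp (-ρ * s) * (k 0 + c) +
        C * X₀ * G.f (u (z s))) (Ioi 0) :=
      (hAi.add ((exp_neg_integrableOn_Ioi 0 hρ).mul_const _)).add (hz'i.const_mul _)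
    refine h1.congr_fun (fun s hs => ?_) measurableSet_Ioi
    have h2 := hXconst s (Ioi_subset_Ici_self hs)
    have h3 : G.ell ρ C c u₀ (u (z s)) = C * G.f (u (z s)) * X (u (z s)) + k s + c := rfl
    simp only [statIntegrand, h3, hA]
    linear_combination (-(C * G.f (u (z s)))) * h2
  refine ⟨hconv, fun v hv w hw hwconv => ?_⟩
  have hwc : ContinuousOn w (Ici 0) := fun s hs => (hw.2 s hs).2.continuousWithinAt
  have hw' : ContinuousOn (fun s => G.f (v (w s))) (Ici 0) :=
    hf.continuousOn.comp (hv.1.continuousOn.comp hwc fun s hs => (hw.2 s hs).1)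
      fun s hs => hv.2 _ (hw.2 s hs).1
  have hpartial : ∀ S ∈ Ici (0 : ℝ),
      ∫ s in (0 : ℝ)..S, statIntegrand (G.ell ρ C c u₀) ρ v w s ≤
        (∫ s in (0 : ℝ)..S, statIntegrand (G.ell ρ C c u₀) ρ u z s) - C * X₀ * z S := fun S hS => by
    have hsub : uIcc 0 S ⊆ Ici 0 := by rw [uIcc_of_le hS]; exact Icc_subset_Ici_self
    have i1 : IntervalIntegrable (statIntegrand (G.ell ρ C c u₀) ρ v w) volume 0 S :=
      (intervalIntegrable_iff_integrableOn_Ioc_of_le hS).2 (hwconv.mono_set Ioc_subset_Ioi_self)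
    have i2 : IntervalIntegrable (statIntegrand (G.ell ρ C c u₀) ρ u z) volume 0 S :=
      (intervalIntegrable_iff_integrableOn_Ioc_of_le hS).2 (hconv.mono_set Ioc_subset_Ioi_self)
    have i3 := (hw'.mono hsub).intervalIntegrable (μ := volume)
    have i4 := (hz'.mono hsub).intervalIntegrable (μ := volume)
    have hle := intervalIntegral.integral_mono_on hS (i1.sub i2) ((i3.sub i4).const_mul (C * X₀))
      fun s hs => by
        have h1 := ell_sub_le hV hu₀V hG hfd hρ.le hC c (hU _ (hz.2 s hs.1).1)
          (hv.2 _ (hw.2 s hs.1).1)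
        have h2 := mul_le_mul_of_nonneg_left h1 (Real.exp_pos (-ρ * s)).le
        have h3 := hXconst s hs.1
        simp only [statIntegrand]
        calc _ = Real.exp (-ρ * s) * (G.ell ρ C c u₀ (v (w s)) - G.ell ρ C c u₀ (u (z s))) := by
              ring
          _ ≤ _ := h2
          _ = _ := by
              linear_combination (C * (G.f (v (w s)) - G.f (u (z s)))) * h3
    rw [intervalIntegral.integral_sub i1 i2, intervalIntegral.integral_const_mul,
      intervalIntegral.integral_sub i3 i4,
      intervalIntegral_eq_sub_of_hasDerivWithinAt_Ici (fun s hs => (hw.2 s hs).2) hw' hS,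
      intervalIntegral_eq_sub_of_hasDerivWithinAt_Ici (fun s hs => (hz.2 s hs).2) hz' hS,
      hz.1, hw.1] at hle
    have h5 := mul_nonneg (neg_nonneg.2 hCX) (hw.2 S hS).1.le
    linarith
  have t1 := intervalIntegral_tendsto_integral_Ioi 0 hwconv Filter.tendsto_id
  have t2 := (intervalIntegral_tendsto_integral_Ioi 0 hconv Filter.tendsto_id).sub
    (hz0.const_mul (C * X₀))
  rw [mul_zero, sub_zero] at t2
  refine le_of_tendsto_of_tendsto t1 t2 ?_
  filter_upwards [Filter.eventually_ge_atTop 0] with S hS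
  exact hpartial S hS

end Stationary

end Oligopoly

/-! ### The rationalization theorem -/

theorem theorem1 {N : ℕ} [NeZero N] (G : Oligopoly N) (hG : G.Standard)
    (hf : ContDiffOn ℝ 2 G.f G.U) (hf' : ∀ u ∈ G.U, derivWithin G.f G.U u ≠ 0) :
    (∃ C : ℝ, C ≠ 0 ∧ ∀ u ∈ G.U, 0 ≤ C * derivWithin G.f G.U u) ∧
    ∀ C : ℝ, (∀ u ∈ G.U, 0 ≤ C * derivWithin G.f G.U u) →
      (∀ (T : ℝ) (u : ℝ → ℝ → ℝ), 0 < T →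
        (∀ t ∈ Set.Icc 0 T, ∀ x ∈ Set.Ioi (0 : ℝ), u t x ∈ interior G.U) →
        G.IsMPNE T (fun t x _ => u t x) →
        Admissible G.f T G.U u →
        ∀ ρ : ℝ, 0 ≤ ρ → ∀ x₀ ∈ Set.Ioi (0 : ℝ), ∀ c₁ c₂ : ℝ,
          let M : Monopoly :=
            ⟨G.ell ρ C c₁ (u T x₀), ρ, G.f, G.bequest ρ C c₂ (u T) x₀⟩
          M.Smooth G.U ∧ M.IsOptimal T G.U u) ∧
      (∀ u : ℝ → ℝ,
        (∀ x ∈ Set.Ioi (0 : ℝ), u x ∈ interior G.U) →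
        G.IsStatMPNE (fun x _ => u x) →
        StatAdmissible G.f G.U u →
        ∀ ρ : ℝ, 0 < ρ → ∀ u₀ ∈ G.U, ∀ c : ℝ,
          let M : Monopoly := ⟨G.ell ρ C c u₀, ρ, G.f, fun _ => 0⟩
          M.Smooth G.U ∧ M.IsStatOptimal G.U u) := by
  have hUD := hG.uniqueDiffOn hf'
  refine ⟨hG.exists_sign hf hf', fun C hC => ⟨?_, ?_⟩⟩
  · intro T u hT hint hM hadm ρ hρ x₀ hx₀ c₁ c₂
    have hTT : T ∈ Icc 0 T := right_mem_Icc.2 hT.le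
    have huU := hadm.1.2
    obtain ⟨ut, ux, h⟩ := exists_hasPartials hT hadm.1.1
    obtain ⟨V, hV⟩ := hG.exists_regularInterval ⟨_, huU T hTT x₀ hx₀⟩
    have hφ : ContDiffOn ℝ 1 (u T) (Ioi 0) :=
      hadm.1.1.comp (f := fun x : ℝ => (T, x)) (contDiff_const.prodMk contDiff_id).contDiffOn
        fun x hx => ⟨hTT, hx⟩
    refine ⟨⟨Oligopoly.contDiffOn_ell hV (hV.subset (huU T hTT x₀ hx₀)) hUD hf ρ C c₁, hf,
      Oligopoly.contDiffOn_bequest hV hφ (fun x hx => hV.subset (huU T hTT x hx)) hx₀ ρ C c₂⟩,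
      Oligopoly.isOptimal_of_equation hG hf hT h ?_ hadm hC hρ hx₀ c₁ c₂⟩
    -- the equation extends to the terminal time by continuity
    intro t ht x hx
    have c0 : ContinuousOn (fun t => (t, x)) (Icc 0 T) := by fun_prop
    have m0 : MapsTo (fun t => (t, x)) (Icc 0 T) (Icc 0 T ×ˢ Ioi 0) := fun t ht => ⟨ht, hx⟩
    have cu : ContinuousOn (fun t => u t x) (Icc 0 T) := h.continuousOn.comp c0 m0
    have mu : MapsTo (fun t => u t x) (Icc 0 T) V := fun t ht => hV.subset (huU t ht x hx)
    have hl : ContinuousOn (fun t => ut t x + G.f (u t x) * ux t x) (Icc 0 T) :=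
      (h.continuousOn_time.comp c0 m0).add
        ((hV.continuousOn_f.comp cu mu).mul (h.continuousOn_state.comp c0 m0))
    have hr : ContinuousOn (fun t => -G.r * G.e (u t x)) (Icc 0 T) :=
      continuousOn_const.mul (hV.continuousOn_e.comp cu mu)
    exact EqOn.of_subset_closure (s := Ico 0 T) (t := Icc 0 T)
      (fun t ht => hM.equation hG h hint ht hx) hl hr Ico_subset_Icc_self
      (closure_Ico hT.ne).ge ht
  · intro u hint hM hadm ρ hρ u₀ hu₀ c
    obtain ⟨V, hV⟩ := hG.exists_regularInterval ⟨_, hu₀⟩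
    have hode : ∀ x ∈ Ioi (0 : ℝ), G.f (u x) * deriv u x = -G.r * G.e (u x) := fun x hx =>
      hM.equation hG hint hx
    exact ⟨⟨Oligopoly.contDiffOn_ell hV (hV.subset hu₀) hUD hf ρ C c, hf, contDiffOn_const⟩,
      Oligopoly.isStatOptimal_of_equation hG hadm.1.1 hode hf
        (Oligopoly.f_neg_of_equation hG hadm.1.1 hode hint hM.1) hadm hC hρ hu₀ c⟩
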